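/- Let $n_x,n_u,N,T\in\mathbb N$ with $T\ge 1$, let $A\in\mathbb R^{n_x\times n_x}$, $B\in\mathbb R^{n_x\times n_u}$, and let $\sigma_u,\sigma_w>0$. Run $N$ independent experiments, $i=1,\dots,N$, on the linear system $$x^{(i)}_{t+1}=Ax^{(i)}_t+Bu^{(i)}_t+w^{(i)}_t,\qquad x^{(i)}_0=0,$$ where all the random vectors $u^{(i)}_t\sim\mathcal N(0,\sigma_u^2I_{n_u})$ and $w^{(i)}_t\sim\mathcal N(0,\sigma_w^2I_{n_x})$ ($1\le i\le N$, $t\ge 0$) are jointly independent. Let $(\hat A,\hat B)$ be the least-squares estimate that uses only the last two data points of each experiment, $$(\hat A,\hat B)\in\arg\min_{(A',B')}\sum_{i=1}^N\bigl\|x^{(i)}_{T+1}-A'x^{(i)}_T-B'u^{(i)}_T\bigr\|_2^2,$$ and let $$\Sigma_x=\sigma_u^2\sum_{t=0}^{T-1}A^tBB^\top(A^\top)^t+\sigma_w^2\sum_{t=0}^{T-1}A^t(A^\top)^t$$ be the covariance matrix of $x^{(i)}_T$. Fix $\delta\in(0,1]$ and assume that $N\ge 24(n_x+n_u)\log(54/\delta)$.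 Then, with probability at least $1-\delta$, the minimizer $(\hat A,\hat B)$ is unique and satisfies both $$\|\hat A-A\|_2\le 8\sigma_w\,\lambda_{\min}(\Sigma_x)^{-1/2}\sqrt{\frac{(2n_x+n_u)\log(54/\delta)}{N}}$$ and $$\|\hat B-B\|_2\le\frac{8\sigma_w}{\sigma_u}\sqrt{\frac{(2n_x+n_u)\log(54/\delta)}{N}},$$ where $\|\cdot\|_2$ is the spectral norm and $\lambda_{\min}$ the smallest eigenvalue. -/

import Mathlib

open MeasureTheory ProbabilityTheory
open scoped Matrix Matrix.Norms.L2Operator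

noncomputable section

/-- State trajectory of the linear system `x (t+1) = A x t + B u t + w t`, started at rest
(`x 0 = 0`), for an input sequence `u` and a noise sequence `w`. -/
def ltiState {nx nu : ℕ} (A : Matrix (Fin nx) (Fin nx) ℝ) (B : Matrix (Fin nx) (Fin nu) ℝ)
    (u : ℕ → EuclideanSpace ℝ (Fin nu)) (w : ℕ → EuclideanSpace ℝ (Fin nx)) :
    ℕ → EuclideanSpace ℝ (Fin nx)
  | 0 => 0
  | t + 1 => Matrix.toEuclideanLin A (ltiState A B u w t) + Matrix.toEuclideanLin B (u t) + w t

/-- The `T`-time-step controllability Gramian `∑_{t=0}^{T} A^t B Bᵀ (Aᵀ)^t` of `(A, B)`. -/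
def ctrlGramian {nx m : ℕ} (A : Matrix (Fin nx) (Fin nx) ℝ) (B : Matrix (Fin nx) (Fin m) ℝ)
    (T : ℕ) : Matrix (Fin nx) (Fin nx) ℝ :=
  ∑ t ∈ Finset.range (T + 1), A ^ t * B * Bᵀ * Aᵀ ^ t

/-- The covariance of the state at time `T ≥ 1` of the system started at rest, with
input covariance `σu² I` and noise covariance `σw² I`:
`σu² ∑_{t=0}^{T-1} A^t B Bᵀ (Aᵀ)^t + σw² ∑_{t=0}^{T-1} A^t (Aᵀ)^t`. -/
def stateCov {nx nu : ℕ} (A : Matrix (Fin nx) (Fin nx) ℝ) (B : Matrix (Fin nx) (Fin nu) ℝ)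
    (σu σw : ℝ) (T : ℕ) : Matrix (Fin nx) (Fin nx) ℝ :=
  σu ^ 2 • ctrlGramian A B (T - 1) + σw ^ 2 • ctrlGramian A (1 : Matrix (Fin nx) (Fin nx) ℝ) (T - 1)

/-- The smallest eigenvalue of a real symmetric matrix. -/
def minEigenvalue {n : ℕ} (M : Matrix (Fin n) (Fin n) ℝ) : ℝ :=
  sInf (spectrum ℝ M)

/-- The least-squares loss `∑ i, ‖y i - A (x i) - B (v i)‖₂²` of `P = (A, B)`. -/
def lsLoss {nx nu N : ℕ} (x : Fin N → EuclideanSpace ℝ (Fin nx))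
    (v : Fin N → EuclideanSpace ℝ (Fin nu)) (y : Fin N → EuclideanSpace ℝ (Fin nx))
    (P : Matrix (Fin nx) (Fin nx) ℝ × Matrix (Fin nx) (Fin nu) ℝ) : ℝ :=
  ∑ i, ‖y i - Matrix.toEuclideanLin P.1 (x i) - Matrix.toEuclideanLin P.2 (v i)‖ ^ 2

/-- `P = (Â, B̂)` minimizes the least-squares loss. -/
def IsLeastSquares {nx nu N : ℕ} (x : Fin N → EuclideanSpace ℝ (Fin nx))
    (v : Fin N → EuclideanSpace ℝ (Fin nu)) (y : Fin N → EuclideanSpace ℝ (Fin nx))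
    (P : Matrix (Fin nx) (Fin nx) ℝ × Matrix (Fin nx) (Fin nu) ℝ) : Prop :=
  ∀ Q, lsLoss x v y P ≤ lsLoss x v y Q

/-- `P = (Â, B̂)` is a least-squares estimate computed from the last two data points
`x (T+1)`, `(x T, u T)` of each of the `N` trajectories with inputs `u i` and noises `w i`. -/
def IsLastStepEstimate {nx nu N : ℕ} (A : Matrix (Fin nx) (Fin nx) ℝ)
    (B : Matrix (Fin nx) (Fin nu) ℝ) (T : ℕ) (u : Fin N → ℕ → EuclideanSpace ℝ (Fin nu))
    (w : Fin N → ℕ → EuclideanSpace ℝ (Fin nx))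
    (P : Matrix (Fin nx) (Fin nx) ℝ × Matrix (Fin nx) (Fin nu) ℝ) : Prop :=
  IsLeastSquares (fun i => ltiState A B (u i) (w i) T) (fun i => u i T)
    (fun i => ltiState A B (u i) (w i) (T + 1)) P

end

/-! The regressors `z i = (x T, u T)` are i.i.d. centered Gaussian with block covariance `S =
diag(Σ_x, σu² I)`, and stacking them as rows of `Z` gives the transposed least-squares error as `(Zᵀ
Z)⁻¹ Zᵀ W`, where the rows of `W` are the last noises. These noises are independent of `Z`.

Two estimates suffice. First, `Zᵀ Z ≥ (N/8) S` with high probability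
(`measureReal_not_quadratic_le`): after whitening, each direction is a chi-square sum, and a net
handles all directions. In particular the minimizer is unique. Second, the error tested against `a`
and `c` is a weighted sum of the noises `a ⬝ᵥ w i` whose squared weights sum to `cᵀ (Zᵀ Z)⁻¹ c`. On
the first event this is at most `8 / (N λ_min(Σ_x))` for `c = (b, 0)` and `8 / (N σu²)` for `c = (0,
b)`, with `b` a unit vector (`sum_sq_olsWeight_le`). With `Z` frozen, the sum has a Gaussian tail
(`measureReal_olsWeight_tail`), and a union bound over pairs of net points controls the spectral
norms.

Testing `Â` and `B̂` separately is what keeps the other block of `S` out of each bound. -/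

/-! ### Nets of the unit sphere and norm bounds from them. -/

section SphereNets

open Module Metric

/-- A `1/8`-separated subset of the unit ball has at most `17 ^ dim` points. -/
theorem card_le_of_separated_ball {E : Type*} [NormedAddCommGroup E] [NormedSpace ℝ E]
    [FiniteDimensional ℝ E] (s : Finset E) (hs : ∀ c ∈ s, ‖c‖ ≤ 1)
    (h : ∀ c ∈ s, ∀ d ∈ s, c ≠ d → 1 / 8 ≤ ‖c - d‖) : s.card ≤ 17 ^ finrank ℝ E := by
  borelize E
  let μ : Measure E := Measure.addHaar
  -- Balls of radius 1/16 around the points are disjoint and lie in the ball of radius 17/16;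
  -- compare volumes.
  have hd : (s : Set E).Pairwise (Function.onFun Disjoint fun c => ball (c : E) (1 / 16)) := by
    rintro c hc d hd hcd
    apply ball_disjoint_ball
    rw [dist_eq_norm]
    linarith [h c hc d hd hcd]
  have hsub : (⋃ c ∈ s, ball (c : E) (1 / 16)) ⊆ ball (0 : E) (17 / 16) := by
    refine Set.iUnion₂_subset fun x hx => ball_subset_ball' ?_
    rw [dist_zero_right]
    linarith [hs x hx]
  have hvol : (s.card : ENNReal) * ENNReal.ofReal ((1 / 16) ^ finrank ℝ E) * μ (ball 0 1) ≤
      ENNReal.ofReal ((17 / 16) ^ finrank ℝ E) * μ (ball 0 1) :=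
    calc
      (s.card : ENNReal) * ENNReal.ofReal ((1 / 16) ^ finrank ℝ E) * μ (ball 0 1)
          = μ (⋃ c ∈ s, ball (c : E) (1 / 16)) := by
        rw [measure_biUnion_finset hd fun c _ => measurableSet_ball]
        simp only [μ.addHaar_ball_of_pos _ (show (0 : ℝ) < 1 / 16 by norm_num),
          Finset.sum_const, nsmul_eq_mul, mul_assoc]
      _ ≤ μ (ball (0 : E) (17 / 16)) := measure_mono hsub
      _ = _ := by rw [μ.addHaar_ball_of_pos _ (show (0 : ℝ) < 17 / 16 by norm_num)]
  have hvol' := (ENNReal.mul_le_mul_iff_left (measure_ball_pos _ _ zero_lt_one).ne'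
    measure_ball_lt_top.ne).1 hvol
  have hcard : (s.card : ℝ) ≤ 17 ^ finrank ℝ E := by
    have h16 : (0 : ℝ) < (1 / 16) ^ finrank ℝ E := by positivity
    rw [← ENNReal.ofReal_natCast, ← ENNReal.ofReal_mul (by positivity),
      ENNReal.ofReal_le_ofReal_iff (by positivity)] at hvol'
    have : (17 / 16 : ℝ) ^ finrank ℝ E = 17 ^ finrank ℝ E * (1 / 16) ^ finrank ℝ E := by
      rw [← mul_pow]; norm_num
    rw [this] at hvol'
    exact le_of_mul_le_mul_right hvol' h16
  exact_mod_cast hcard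

/-- `s` is a finite set of unit vectors that is `1/8`-dense in the unit sphere. -/
def IsSphereNet {E : Type*} [NormedAddCommGroup E] (s : Finset E) : Prop :=
  (∀ v ∈ s, ‖v‖ = 1) ∧ ∀ v : E, ‖v‖ = 1 → ∃ c ∈ s, ‖v - c‖ ≤ 1 / 8

/-- A separated subset of the sphere of maximal cardinality is a net, since an uncovered point could
be added to it. -/
theorem exists_isSphereNet (E : Type*) [NormedAddCommGroup E] [NormedSpace ℝ E]
    [FiniteDimensional ℝ E] : ∃ s : Finset E, IsSphereNet s ∧ s.card ≤ 17 ^ finrank ℝ E := by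
  classical
  let S : Set ℕ := {n | ∃ s : Finset E, s.card = n ∧ (∀ c ∈ s, ‖c‖ = 1) ∧
    ∀ c ∈ s, ∀ d ∈ s, c ≠ d → 1 / 8 ≤ ‖c - d‖}
  have hb : BddAbove S := by
    refine ⟨17 ^ finrank ℝ E, ?_⟩
    rintro n ⟨s, rfl, h1, h2⟩
    exact card_le_of_separated_ball s (fun c hc => (h1 c hc).le) h2
  have hne : S.Nonempty := ⟨0, ∅, by simp⟩
  obtain ⟨s, hs, h1, h2⟩ := Nat.sSup_mem hne hb
  refine ⟨s, ⟨h1, fun v hv => ?_⟩, card_le_of_separated_ball s (fun c hc => (h1 c hc).le) h2⟩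
  by_contra! hcon
  have hvs : v ∉ s := fun hvs => by
    have := hcon v hvs
    norm_num at this
  have hmem : s.card + 1 ∈ S := by
    refine ⟨insert v s, Finset.card_insert_of_notMem hvs, ?_, ?_⟩
    · simpa [hv] using h1
    · intro c hc d hd hcd
      rcases Finset.mem_insert.1 hc with rfl | hcs <;>
        rcases Finset.mem_insert.1 hd with rfl | hds
      · exact absurd rfl hcd
      · exact (hcon d hds).le
      · rw [norm_sub_rev]; exact (hcon c hcs).le
      · exact h2 c hcs d hds hcd
  have := le_csSup hb hmem
  omega

variable {E F : Type*} [NormedAddCommGroup E]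

/-- Moving to the nearest net point costs at most `‖G‖ / 8`, which is absorbed on the left. -/
theorem opNorm_le_of_isSphereNet [NormedSpace ℝ E] [NormedAddCommGroup F] [NormedSpace ℝ F]
    {s : Finset E} (hs : IsSphereNet s) (G : E →L[ℝ] F) {β : ℝ} (hβ : 0 ≤ β)
    (h : ∀ c ∈ s, ‖G c‖ ≤ β) : ‖G‖ ≤ 8 / 7 * β := by
  have key : ‖G‖ ≤ β + ‖G‖ / 8 := by
    refine G.opNorm_le_of_unit_norm (by positivity) fun v hv => ?_
    obtain ⟨c, hc, hvc⟩ := hs.2 v hv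
    calc ‖G v‖ = ‖G c + G (v - c)‖ := by rw [← map_add, add_sub_cancel]
      _ ≤ ‖G c‖ + ‖G‖ * ‖v - c‖ := (norm_add_le _ _).trans (by gcongr; exact G.le_opNorm _)
      _ ≤ β + ‖G‖ * (1 / 8) := by gcongr; exact h c hc
      _ = _ := by ring
  linarith

/-- The loss `β / 7` is the operator norm bound `8 / 7 * β` times the mesh `1 / 8`. -/
theorem le_norm_of_isSphereNet [NormedSpace ℝ E] [NormedAddCommGroup F] [NormedSpace ℝ F]
    {s : Finset E} (hs : IsSphereNet s) (G : E →L[ℝ] F) {α β : ℝ} (hβ : 0 ≤ β)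
    (h : ∀ c ∈ s, ‖G c‖ ≤ β) (h' : ∀ c ∈ s, α ≤ ‖G c‖) (v : E) :
    (α - β / 7) * ‖v‖ ≤ ‖G v‖ := by
  have key : ∀ v, ‖v‖ = 1 → α - β / 7 ≤ ‖G v‖ := by
    intro v hv
    obtain ⟨c, hc, hvc⟩ := hs.2 v hv
    have hG := opNorm_le_of_isSphereNet hs G hβ h
    have : ‖G c‖ ≤ ‖G v‖ + ‖G‖ * ‖v - c‖ := by
      calc ‖G c‖ = ‖G v - G (v - c)‖ := by rw [← map_sub, sub_sub_cancel]
        _ ≤ _ := (norm_sub_le _ _).trans (by gcongr; exact G.le_opNorm _)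
    have h3 : ‖G‖ * ‖v - c‖ ≤ 8 / 7 * β * (1 / 8) := by gcongr
    linarith [h' c hc]
  rcases eq_or_ne v 0 with rfl | hv
  · simp
  have hv' : 0 < ‖v‖ := norm_pos_iff.2 hv
  have := key (‖v‖⁻¹ • v) (by rw [norm_smul, norm_inv, norm_norm, inv_mul_cancel₀ hv'.ne'])
  rw [map_smul, norm_smul, norm_inv, norm_norm] at this
  calc (α - β / 7) * ‖v‖ ≤ ‖v‖⁻¹ * ‖G v‖ * ‖v‖ := by gcongr
    _ = ‖G v‖ := by field_simp

/-- Both arguments of the bilinear form are moved to net points, at a cost of `‖M‖ / 8` each. -/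
theorem opNorm_le_of_isSphereNet_inner [NormedSpace ℝ E] [NormedAddCommGroup F]
    [InnerProductSpace ℝ F] {s : Finset E} (hs : IsSphereNet s) {t : Finset F}
    (ht : IsSphereNet t) (M : E →L[ℝ] F) {K : ℝ} (hK : 0 ≤ K)
    (h : ∀ a ∈ t, ∀ b ∈ s, inner ℝ a (M b) ≤ K) : ‖M‖ ≤ 4 / 3 * K := by
  have key : ‖M‖ ≤ K + ‖M‖ / 4 := by
    refine M.opNorm_le_of_unit_norm (by positivity) fun v hv => ?_
    rcases eq_or_ne (M v) 0 with h0 | h0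
    · rw [h0, norm_zero]; positivity
    have hpos : 0 < ‖M v‖ := norm_pos_iff.2 h0
    obtain ⟨b, hb, hvb⟩ := hs.2 v hv
    obtain ⟨a, ha, hva⟩ := ht.2 (‖M v‖⁻¹ • M v)
      (by rw [norm_smul, norm_inv, norm_norm, inv_mul_cancel₀ hpos.ne'])
    set e := ‖M v‖⁻¹ • M v with he
    have h1 : ‖M v‖ = inner ℝ e (M v) := by
      rw [he, real_inner_smul_left, real_inner_self_eq_norm_sq]
      field_simp
    have h2 : inner ℝ e (M v) = inner ℝ a (M b) + inner ℝ (e - a) (M v)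
        + inner ℝ a (M (v - b)) := by
      rw [inner_sub_left, map_sub, inner_sub_right]; ring
    have h3 : inner ℝ (e - a) (M v) ≤ 1 / 8 * (‖M‖ * 1) := by
      refine (real_inner_le_norm _ _).trans ?_
      gcongr
      rw [← hv]; exact M.le_opNorm v
    have h4 : inner ℝ a (M (v - b)) ≤ 1 * (‖M‖ * (1 / 8)) := by
      refine (real_inner_le_norm _ _).trans ?_
      rw [ht.1 a ha]
      gcongr
      exact (M.le_opNorm _).trans (by gcongr)
    rw [h1, h2]
    linarith [h a ha b hb]
  linarith

end SphereNets

/-! ### Chi-square and Gaussian tails. -/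

section TailBounds

variable {Ω : Type*} [MeasurableSpace Ω] {μ : Measure Ω}

theorem mgf_sq_of_hasLaw_gaussianReal {X : Ω → ℝ} (hX : HasLaw X (gaussianReal 0 1) μ) {t : ℝ}
    (ht : t < 1 / 2) : mgf (fun ω => X ω ^ 2) μ t = √(1 - 2 * t)⁻¹ := by
  have h1 : mgf (fun ω => X ω ^ 2) μ t = ∫ x, Real.exp (t * x ^ 2) ∂(gaussianReal 0 1) := by
    rw [mgf, ← hX.integral_comp (f := fun x : ℝ => Real.exp (t * x ^ 2)) (by fun_prop)]
    rfl
  rw [h1, integral_gaussianReal_eq_integral_smul one_ne_zero]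
  have h2 : ∀ x : ℝ, gaussianPDFReal 0 1 x • Real.exp (t * x ^ 2)
      = (√(2 * Real.pi))⁻¹ * Real.exp (-(1 / 2 - t) * x ^ 2) := by
    intro x
    simp only [gaussianPDFReal, NNReal.coe_one, mul_one, sub_zero, smul_eq_mul]
    rw [mul_assoc, ← Real.exp_add]
    ring_nf
  simp_rw [h2]
  rw [integral_const_mul, integral_gaussian, ← Real.sqrt_inv, ← Real.sqrt_mul (by positivity)]
  congr 1
  have : (1 - 2 * t) ≠ 0 := by linarith
  have : (1 / 2 - t) ≠ 0 := by linarith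
  field_simp

variable {N : ℕ} {X : Fin N → Ω → ℝ}

theorem mgf_sum_sq_of_iIndepFun (hind : iIndepFun X μ)
    (hX : ∀ i, HasLaw (X i) (gaussianReal 0 1) μ) {t : ℝ} (ht : t < 1 / 2) :
    mgf (fun ω => ∑ i, X i ω ^ 2) μ t = √(1 - 2 * t)⁻¹ ^ N := by
  have h := (hind.comp (fun _ x => x ^ 2) (fun _ => by fun_prop)).mgf_sum₀ (t := t)
    (fun i => (show Measurable fun x : ℝ => x ^ 2 by fun_prop).comp_aemeasurable
      (hX i).aemeasurable) Finset.univ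
  have e : (∑ i, (fun x : ℝ => x ^ 2) ∘ X i) = fun ω => ∑ i, X i ω ^ 2 := by
    ext ω; simp
  rw [e] at h
  rw [h]
  have : ∀ i, mgf ((fun x : ℝ => x ^ 2) ∘ X i) μ t = √(1 - 2 * t)⁻¹ :=
    fun i => mgf_sq_of_hasLaw_gaussianReal (hX i) ht
  simp [this]

theorem integrable_exp_mul_sum_sq_of_iIndepFun (hind : iIndepFun X μ)
    (hX : ∀ i, HasLaw (X i) (gaussianReal 0 1) μ) {t : ℝ} (ht : t < 1 / 2) :
    Integrable (fun ω => Real.exp (t * ∑ i, X i ω ^ 2)) μ := by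
  have := hind.isProbabilityMeasure
  -- A non-integrable exponential would have `mgf` zero, so the positive closed form yields
  -- integrability.
  rw [← mgf_pos_iff (X := fun ω => ∑ i, X i ω ^ 2), mgf_sum_sq_of_iIndepFun hind hX ht]
  exact pow_pos (Real.sqrt_pos.2 (inv_pos.2 (by linarith))) _

/-- Chernoff at `t = 1/4`: the factor per sample is `exp (-1/2) * √2`, and `log 2 / 2 ≤ 5/12`. -/
theorem measureReal_two_mul_le_sum_sq (hind : iIndepFun X μ)
    (hX : ∀ i, HasLaw (X i) (gaussianReal 0 1) μ) :
    μ.real {ω | 2 * (N : ℝ) ≤ ∑ i, X i ω ^ 2} ≤ Real.exp (-(N / 12)) := by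
  have := hind.isProbabilityMeasure
  refine (measure_ge_le_exp_mul_mgf (t := 1 / 4) _ (by norm_num)
    (integrable_exp_mul_sum_sq_of_iIndepFun hind hX (by norm_num))).trans ?_
  rw [mgf_sum_sq_of_iIndepFun hind hX (by norm_num)]
  have h2 : √(1 - 2 * (1 / 4 : ℝ))⁻¹ ≤ Real.exp (5 / 12) := by
    rw [Real.sqrt_le_left (Real.exp_pos _).le, ← Real.exp_nat_mul]
    rw [← Real.log_le_iff_le_exp (by norm_num)]
    norm_num
    linarith [Real.log_two_lt_d9]
  calc Real.exp (-(1 / 4) * (2 * N)) * √(1 - 2 * (1 / 4 : ℝ))⁻¹ ^ N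
      ≤ Real.exp (-(1 / 4) * (2 * N)) * Real.exp (5 / 12) ^ N := by gcongr
    _ = Real.exp (-(N / 12)) := by
      rw [← Real.exp_nat_mul, ← Real.exp_add]; ring_nf

/-- Chernoff at `t = -1`: the factor per sample is `exp (1/3) / √3`. Using `5/12` again gives both
tails the rate `1/12`. -/
theorem measureReal_sum_sq_le_div_three (hind : iIndepFun X μ)
    (hX : ∀ i, HasLaw (X i) (gaussianReal 0 1) μ) :
    μ.real {ω | ∑ i, X i ω ^ 2 ≤ (N : ℝ) / 3} ≤ Real.exp (-(N / 12)) := by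
  have := hind.isProbabilityMeasure
  refine (measure_le_le_exp_mul_mgf (t := -1) _ (by norm_num)
    (integrable_exp_mul_sum_sq_of_iIndepFun hind hX (by norm_num))).trans ?_
  rw [mgf_sum_sq_of_iIndepFun hind hX (by norm_num)]
  have h2 : √(1 - 2 * (-1 : ℝ))⁻¹ ≤ Real.exp (-(5 / 12)) := by
    rw [Real.sqrt_le_left (Real.exp_pos _).le, ← Real.exp_nat_mul]
    rw [← Real.log_le_iff_le_exp (by norm_num), Real.log_inv]
    have h3 : 1 ≤ Real.log 3 := by
      rw [Real.le_log_iff_exp_le (by norm_num)]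
      linarith [Real.exp_one_lt_d9]
    norm_num
    linarith
  calc Real.exp (- -1 * ((N : ℝ) / 3)) * √(1 - 2 * (-1 : ℝ))⁻¹ ^ N
      ≤ Real.exp (- -1 * ((N : ℝ) / 3)) * Real.exp (-(5 / 12)) ^ N := by gcongr
    _ = Real.exp (-(N / 12)) := by
      rw [← Real.exp_nat_mul, ← Real.exp_add]; ring_nf

/-- The weights are deterministic here; `κ` only has to bound their squared sum, so the tail is
uniform in them. -/
theorem measureReal_le_sum_mul_gaussian {v : NNReal} (hind : iIndepFun X μ)
    (hX : ∀ i, HasLaw (X i) (gaussianReal 0 v) μ) {h : Fin N → ℝ} {κ s : ℝ}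
    (hκ : ∑ i, h i ^ 2 ≤ κ) (hs : 0 ≤ s) :
    μ.real {ω | s ≤ ∑ i, h i * X i ω} ≤ Real.exp (-s ^ 2 / (2 * (κ * v))) := by
  have hκ0 : 0 ≤ κ := (Finset.sum_nonneg fun i _ => sq_nonneg (h i)).trans hκ
  have hsub : ∀ i, HasSubgaussianMGF (fun ω => h i * X i ω) (Real.toNNReal (h i ^ 2) * v) μ := by
    intro i
    rw [Real.toNNReal_of_nonneg (sq_nonneg _)]
    refine HasSubgaussianMGF.const_mul (X := X i) ⟨fun t => ?_, fun t => ?_⟩ (h i)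
    · have := hX i |>.isProbabilityMeasure
      rw [← mgf_pos_iff, mgf_gaussianReal (hX i).map_eq]
      exact Real.exp_pos _
    · rw [mgf_gaussianReal (hX i).map_eq]; simp
  have hsum := HasSubgaussianMGF.sum_of_iIndepFun (s := Finset.univ)
    (hind.comp (fun i x => h i * x) (fun _ => by fun_prop)) (fun i _ => hsub i)
  have hsum' : HasSubgaussianMGF (fun ω => ∑ i, h i * X i ω) (κ.toNNReal * v) μ := by
    refine ⟨hsum.integrable_exp_mul, fun t => (hsum.mgf_le t).trans ?_⟩
    rw [← Finset.sum_mul]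
    simp only [NNReal.coe_mul, NNReal.coe_sum, Real.coe_toNNReal _ hκ0,
      Real.coe_toNNReal _ (sq_nonneg (h _))]
    gcongr
  simpa [Real.coe_toNNReal _ hκ0] using hsum'.measure_ge_le hs

end TailBounds

/-! ### Freezing one of two independent variables, and regrouping independent σ-algebras. -/

section Independence

variable {Ω : Type*} [mΩ : MeasurableSpace Ω] {μ : Measure Ω}

/-- If every section of `S` has measure at most `ε` under the law of `W`, then `(Z, W)` lies in
`S` with probability at most `ε`, provided that `Z` and `W` are independent. -/
theorem measureReal_prodMk_mem_le_of_indepFun {α β : Type*} [MeasurableSpace α]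
    [MeasurableSpace β] [IsProbabilityMeasure μ] {Z : Ω → α} {W : Ω → β} (hZ : Measurable Z)
    (hW : Measurable W) (hind : IndepFun Z W μ) {S : Set (α × β)} (hS : MeasurableSet S) {ε : ℝ}
    (hε : 0 ≤ ε) (h : ∀ z, μ.real {ω | (z, W ω) ∈ S} ≤ ε) :
    μ.real {ω | (Z ω, W ω) ∈ S} ≤ ε := by
  have hp : IsProbabilityMeasure (μ.map Z) := Measure.isProbabilityMeasure_map hZ.aemeasurable
  have h1 : μ {ω | (Z ω, W ω) ∈ S} = ((μ.map Z).prod (μ.map W)) S := by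
    rw [← hind.map_prod_eq_prod_map_map hZ.aemeasurable hW.aemeasurable,
      Measure.map_apply (hZ.prodMk hW) hS]
    rfl
  refine ENNReal.toReal_le_of_le_ofReal hε ?_
  rw [h1, Measure.prod_apply hS]
  calc ∫⁻ z, μ.map W (Prod.mk z ⁻¹' S) ∂(μ.map Z)
      ≤ ∫⁻ _, ENNReal.ofReal ε ∂(μ.map Z) := by
        refine lintegral_mono fun z => ?_
        rw [Measure.map_apply hW (measurable_prodMk_left hS)]
        exact (ENNReal.le_ofReal_iff_toReal_le (measure_ne_top _ _) hε).2 (h z)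
    _ = ENNReal.ofReal ε := by simp

/-- Grouping independent σ-algebras into disjoint blocks gives independent σ-algebras. -/
theorem ProbabilityTheory.iIndep.iSup_fiber {K I : Type*}
    {m : K → MeasurableSpace Ω} (hle : ∀ k, m k ≤ mΩ) (hm : iIndep m μ) (f : K → I) :
    iIndep (fun i => ⨆ k ∈ f ⁻¹' {i}, m k) μ := by
  classical
  have := hm.isProbabilityMeasure
  rw [iIndep_iff]
  intro s g hg
  induction s using Finset.induction_on with
  | empty => simp
  | insert i s hi ih =>
    rw [Finset.set_biInter_insert, Finset.prod_insert hi,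
      ← ih fun j hj => hg j (Finset.mem_insert_of_mem hj)]
    have hdisj : Disjoint (f ⁻¹' {i}) (f ⁻¹' s) :=
      Disjoint.preimage f (by simpa using hi)
    refine (Indep_iff _ _ μ).1 (indep_iSup_of_disjoint hle hm hdisj) _ _
      (hg i (Finset.mem_insert_self _ _)) (Finset.measurableSet_biInter _ fun j hj => ?_)
    refine (iSup₂_le fun k hk => ?_ : (⨆ k ∈ f ⁻¹' {j}, m k) ≤ _) _
      (hg j (Finset.mem_insert_of_mem hj))
    refine le_iSup₂_of_le k ?_ le_rfl
    simp only [Set.mem_preimage, Set.mem_singleton_iff] at hk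
    simpa [hk] using hj

/-- Two independent families of independent σ-algebras are jointly independent. -/
theorem ProbabilityTheory.iIndep.sumElim {K I : Type*}
    {m : K → MeasurableSpace Ω} {m' : I → MeasurableSpace Ω} (hm : iIndep m μ)
    (hm' : iIndep m' μ) (h : Indep (⨆ k, m k) (⨆ i, m' i) μ) : iIndep (Sum.elim m m') μ := by
  classical
  rw [iIndep_iff]
  intro s g hg
  have hl : ∀ k ∈ s.toLeft, MeasurableSet[m k] (g (Sum.inl k)) :=
    fun k hk => hg _ (Finset.mem_toLeft.1 hk)
  have hr : ∀ k ∈ s.toRight, MeasurableSet[m' k] (g (Sum.inr k)) :=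
    fun k hk => hg _ (Finset.mem_toRight.1 hk)
  have hs : (⋂ k ∈ s, g k)
      = (⋂ k ∈ s.toLeft, g (Sum.inl k)) ∩ ⋂ k ∈ s.toRight, g (Sum.inr k) := by
    ext ω
    simp [Sum.forall]
  rw [hs, (Indep_iff _ _ μ).1 h _ _
    (Finset.measurableSet_biInter _ fun k hk => le_iSup m k _ (hl k hk))
    (Finset.measurableSet_biInter _ fun k hk => le_iSup m' k _ (hr k hk)),
    hm.meas_biInter hl, hm'.meas_biInter hr]
  conv_rhs => rw [← Finset.toLeft_disjSum_toRight (u := s)]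
  rw [Finset.prod_disjSum]

end Independence

/-! ### Lower bound for the empirical covariance. -/

section EmpiricalCovariance

/-- A positive definite real matrix is `Rᵀ R` for an invertible `R`. -/
theorem Matrix.PosDef.exists_isUnit_transpose_mul_self {ι : Type*} [Fintype ι] [DecidableEq ι]
    {S : Matrix ι ι ℝ} (hS : S.PosDef) : ∃ R : Matrix ι ι ℝ, IsUnit R ∧ S = Rᵀ * R := by
  open scoped MatrixOrder ComplexOrder in
  obtain ⟨R, hR⟩ := CStarAlgebra.nonneg_iff_eq_star_mul_self.1 hS.posSemidef.nonneg
  have hR' : S = Rᵀ * R := by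
    rw [hR, Matrix.star_eq_conjTranspose, Matrix.conjTranspose_eq_transpose_of_trivial]
  refine ⟨R, ?_, hR'⟩
  have h := hS.det_pos.ne'
  rw [hR', Matrix.det_mul] at h
  exact (Matrix.isUnit_iff_isUnit_det _).2 (isUnit_iff_ne_zero.2 (right_ne_zero_of_mul h))

/-- Source of the factor `1/8`: net values between `√(N/3)` and `√(2N)` give the lower bound
`√(N/8)` on the whole sphere. -/
theorem sqrt_div_eight_le (x : ℝ) : √(x / 8) ≤ √(x / 3) - √(2 * x) / 7 := by
  rcases le_or_gt x 0 with hx | hx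
  · rw [Real.sqrt_eq_zero_of_nonpos (by linarith), Real.sqrt_eq_zero_of_nonpos (by linarith),
      Real.sqrt_eq_zero_of_nonpos (by linarith)]
    simp
  · have e8 : √(x / 8) = √x * √(1 / 8) := by rw [← Real.sqrt_mul hx.le]; ring_nf
    have e3 : √(x / 3) = √x * √(1 / 3) := by rw [← Real.sqrt_mul hx.le]; ring_nf
    have e2 : √(2 * x) = √x * √2 := by rw [← Real.sqrt_mul hx.le]; ring_nf
    rw [e8, e3, e2]
    have h8 : √(1 / 8) ≤ 0.36 := by rw [Real.sqrt_le_left (by norm_num)]; norm_num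
    have h3 : 0.57 ≤ √(1 / 3) := by
      rw [Real.le_sqrt (by norm_num) (by norm_num)]; norm_num
    have h2 : √2 ≤ 1.42 := by rw [Real.sqrt_le_left (by norm_num)]; norm_num
    have : √x * √(1 / 8) ≤ √x * (√(1 / 3) - √2 / 7) := by gcongr; linarith
    linarith

variable {Ω : Type*} [MeasurableSpace Ω] {μ : Measure Ω}

/-- For `N` i.i.d. centered Gaussian vectors with covariance `S`, the empirical covariance
dominates `S / 8` with high probability. -/
theorem measureReal_not_quadratic_le {ι : Type*} [Fintype ι] [DecidableEq ι] {N : ℕ}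
    (z : Fin N → Ω → ι → ℝ) {S : Matrix ι ι ℝ} (hS : S.PosDef)
    (hind : ∀ c : ι → ℝ, iIndepFun (fun i ω => c ⬝ᵥ z i ω) μ)
    (hlaw : ∀ (c : ι → ℝ) i, HasLaw (fun ω => c ⬝ᵥ z i ω)
      (gaussianReal 0 (c ⬝ᵥ S *ᵥ c).toNNReal) μ) :
    μ.real {ω | ¬ ∀ c : ι → ℝ, (N : ℝ) / 8 * (c ⬝ᵥ S *ᵥ c) ≤ ∑ i, (c ⬝ᵥ z i ω) ^ 2} ≤
      2 * 17 ^ Fintype.card ι * Real.exp (-(N / 12)) := by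
  have := (hind 0).isProbabilityMeasure
  obtain ⟨R, hR, rfl⟩ := hS.exists_isUnit_transpose_mul_self
  have hdet : IsUnit R.det := (Matrix.isUnit_iff_isUnit_det _).1 hR
  obtain ⟨s, hs, hcard⟩ := exists_isSphereNet (EuclideanSpace ℝ ι)
  rw [finrank_euclideanSpace] at hcard
  -- Whitening: in the direction `R⁻¹ v` with `‖v‖ = 1`, the sample has variance one.
  let Y : EuclideanSpace ℝ ι → Fin N → Ω → ℝ := fun v i ω => (R⁻¹ *ᵥ v.ofLp) ⬝ᵥ z i ω
  have hquad : ∀ c : ι → ℝ, c ⬝ᵥ (Rᵀ * R) *ᵥ c = ‖WithLp.toLp 2 (R *ᵥ c)‖ ^ 2 := by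
    intro c
    rw [EuclideanSpace.real_norm_sq_eq, ← Matrix.mulVec_mulVec, Matrix.dotProduct_mulVec,
      Matrix.vecMul_transpose]
    simp [dotProduct, sq]
  have hYlaw : ∀ v ∈ s, ∀ i, HasLaw (Y v i) (gaussianReal 0 1) μ := by
    intro v hv i
    have h := hlaw (R⁻¹ *ᵥ v.ofLp) i
    rw [hquad, Matrix.mulVec_mulVec, Matrix.mul_nonsing_inv _ hdet, Matrix.one_mulVec] at h
    simpa [hs.1 v hv] using h
  let bad : EuclideanSpace ℝ ι → Set Ω := fun v =>
    {ω | 2 * (N : ℝ) ≤ ∑ i, Y v i ω ^ 2} ∪ {ω | ∑ i, Y v i ω ^ 2 ≤ (N : ℝ) / 3}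
  have hbad : ∀ v ∈ s, μ.real (bad v) ≤ 2 * Real.exp (-(N / 12)) := by
    intro v hv
    refine (measureReal_union_le _ _).trans ?_
    linarith [measureReal_two_mul_le_sum_sq (hind _) (hYlaw v hv),
      measureReal_sum_sq_le_div_three (hind _) (hYlaw v hv)]
  have hsub : {ω | ¬ ∀ c : ι → ℝ,
      (N : ℝ) / 8 * (c ⬝ᵥ (Rᵀ * R) *ᵥ c) ≤ ∑ i, (c ⬝ᵥ z i ω) ^ 2} ⊆ ⋃ v ∈ s, bad v := by
    intro ω hω
    by_contra hcon
    simp only [bad, Set.mem_iUnion, Set.mem_union, Set.mem_ofPred_eq, not_exists, not_or,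
      not_le] at hcon
    apply hω
    intro c
    let G : EuclideanSpace ℝ ι →L[ℝ] EuclideanSpace ℝ (Fin N) := LinearMap.toContinuousLinearMap
      { toFun := fun v => WithLp.toLp 2 fun i => Y v i ω
        map_add' := fun v w => by
          ext i; simp [Y, Matrix.mulVec_add]
        map_smul' := fun r v => by
          ext i; simp [Y, Matrix.mulVec_smul] }
    have hG : ∀ v, ‖G v‖ ^ 2 = ∑ i, Y v i ω ^ 2 := fun v => by
      rw [EuclideanSpace.real_norm_sq_eq]; rfl
    have hup : ∀ v ∈ s, ‖G v‖ ≤ √(2 * N) := fun v hv =>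
      Real.le_sqrt_of_sq_le (by rw [hG]; exact (hcon v hv).1.le)
    have hlo : ∀ v ∈ s, √((N : ℝ) / 3) ≤ ‖G v‖ := fun v hv =>
      Real.sqrt_le_iff.2 ⟨norm_nonneg _, by rw [hG]; exact (hcon v hv).2.le⟩
    -- Evaluation at `R c` undoes the whitening, so an arbitrary `c` is reached.
    have h := le_norm_of_isSphereNet hs G (Real.sqrt_nonneg _) hup hlo
      (WithLp.toLp 2 (R *ᵥ c))
    have h' : √((N : ℝ) / 8) * ‖WithLp.toLp 2 (R *ᵥ c)‖ ≤ ‖G (WithLp.toLp 2 (R *ᵥ c))‖ :=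
      (by gcongr; exact sqrt_div_eight_le _ : _ ≤ _).trans h
    have h2 := pow_le_pow_left₀ (by positivity) h' 2
    rw [mul_pow, Real.sq_sqrt (by positivity), hG] at h2
    rw [hquad]
    refine h2.trans_eq (Finset.sum_congr rfl fun i _ => ?_)
    simp only [Y]
    rw [Matrix.mulVec_mulVec, Matrix.nonsing_inv_mul _ hdet, Matrix.one_mulVec]
  calc _ ≤ μ.real (⋃ v ∈ s, bad v) := measureReal_mono hsub (measure_ne_top _ _)
    _ ≤ ∑ v ∈ s, μ.real (bad v) := measureReal_biUnion_finset_le _ _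
    _ ≤ ∑ v ∈ s, 2 * Real.exp (-(N / 12)) := Finset.sum_le_sum hbad
    _ = s.card * (2 * Real.exp (-(N / 12))) := by rw [Finset.sum_const, nsmul_eq_mul]
    _ ≤ (17 ^ Fintype.card ι : ℕ) * (2 * Real.exp (-(N / 12))) := by gcongr
    _ = _ := by push_cast; ring

end EmpiricalCovariance

/-! ### Which inputs and noises a quantity depends on. -/

section NoiseMeasurability

variable {Ω : Type*} {nx nu N : ℕ}

/-- The σ-algebras generated by the individual inputs and noises. -/
@[reducible]
def noiseSigma (u : Fin N → ℕ → Ω → EuclideanSpace ℝ (Fin nu))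
    (w : Fin N → ℕ → Ω → EuclideanSpace ℝ (Fin nx)) :
    (Fin N × ℕ) ⊕ (Fin N × ℕ) → MeasurableSpace Ω :=
  Sum.elim (fun p => MeasurableSpace.comap (u p.1 p.2) inferInstance)
    (fun p => MeasurableSpace.comap (w p.1 p.2) inferInstance)

theorem iSup_comap_le_comap_pi {ι E : Type*} [MeasurableSpace E] (f : ι → Ω → E) :
    (⨆ i, MeasurableSpace.comap (f i) inferInstance) ≤
      MeasurableSpace.comap (fun ω i => f i ω) inferInstance := by
  refine iSup_le fun i => ?_
  rintro _ ⟨s, hs, rfl⟩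
  exact ⟨(fun g : ι → E => g i) ⁻¹' s, measurable_pi_apply i hs, rfl⟩

variable {u : Fin N → ℕ → Ω → EuclideanSpace ℝ (Fin nu)}
  {w : Fin N → ℕ → Ω → EuclideanSpace ℝ (Fin nx)}

/-- Dependence on a set `S` of inputs and noises is encoded as measurability for the supremum of
their σ-algebras; disjoint sets then give independence. -/
theorem measurable_input_of_mem {S : Set ((Fin N × ℕ) ⊕ (Fin N × ℕ))} {i : Fin N} {t : ℕ}
    (h : Sum.inl (i, t) ∈ S) : Measurable[⨆ k ∈ S, noiseSigma u w k] (u i t) :=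
  (comap_measurable (u i t)).mono (le_iSup₂_of_le (Sum.inl (i, t)) h le_rfl) le_rfl

theorem measurable_noise_of_mem {S : Set ((Fin N × ℕ) ⊕ (Fin N × ℕ))} {i : Fin N} {t : ℕ}
    (h : Sum.inr (i, t) ∈ S) : Measurable[⨆ k ∈ S, noiseSigma u w k] (w i t) :=
  (comap_measurable (w i t)).mono (le_iSup₂_of_le (Sum.inr (i, t)) h le_rfl) le_rfl

/-- The σ-algebra `m` is arbitrary so that the same statement serves the ambient one and those
generated by selected noises. -/
theorem measurable_ltiState {m : MeasurableSpace Ω} (A : Matrix (Fin nx) (Fin nx) ℝ)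
    (B : Matrix (Fin nx) (Fin nu) ℝ) {u : ℕ → Ω → EuclideanSpace ℝ (Fin nu)}
    {w : ℕ → Ω → EuclideanSpace ℝ (Fin nx)} {T : ℕ} (hu : ∀ t < T, Measurable[m] (u t))
    (hw : ∀ t < T, Measurable[m] (w t)) :
    Measurable[m] fun ω => ltiState A B (fun t => u t ω) (fun t => w t ω) T := by
  induction T with
  | zero => exact measurable_const
  | succ T ih =>
    have hA : Measurable (Matrix.toEuclideanLin A) :=
      (LinearMap.continuous_of_finiteDimensional _).measurable
    have hB : Measurable (Matrix.toEuclideanLin B) :=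
      (LinearMap.continuous_of_finiteDimensional _).measurable
    exact ((hA.comp (ih (fun t ht => hu t (ht.trans T.lt_succ_self))
      (fun t ht => hw t (ht.trans T.lt_succ_self)))).add
      (hB.comp (hu T T.lt_succ_self))).add (hw T T.lt_succ_self)

theorem measurable_dotProduct_const {m : MeasurableSpace Ω} {n : ℕ}
    {X : Ω → EuclideanSpace ℝ (Fin n)} (hX : Measurable[m] X) (a : Fin n → ℝ) :
    Measurable[m] fun ω => a ⬝ᵥ (X ω).ofLp :=
  (show Measurable fun x : EuclideanSpace ℝ (Fin n) => a ⬝ᵥ x.ofLp by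
    unfold dotProduct; fun_prop).comp hX

/-- The regression vector `(x T, u T)` of a trajectory. -/
noncomputable def regressor (A : Matrix (Fin nx) (Fin nx) ℝ) (B : Matrix (Fin nx) (Fin nu) ℝ) (T : ℕ)
    (u : ℕ → EuclideanSpace ℝ (Fin nu)) (w : ℕ → EuclideanSpace ℝ (Fin nx)) :
    Fin nx ⊕ Fin nu → ℝ :=
  Sum.elim (ltiState A B u w T).ofLp (u T).ofLp

theorem measurable_regressor {m : MeasurableSpace Ω} (A : Matrix (Fin nx) (Fin nx) ℝ)
    (B : Matrix (Fin nx) (Fin nu) ℝ) {u : ℕ → Ω → EuclideanSpace ℝ (Fin nu)}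
    {w : ℕ → Ω → EuclideanSpace ℝ (Fin nx)} {T : ℕ} (hu : ∀ t ≤ T, Measurable[m] (u t))
    (hw : ∀ t < T, Measurable[m] (w t)) :
    Measurable[m] fun ω => regressor A B T (fun t => u t ω) (fun t => w t ω) := by
  have hx := measurable_ltiState A B (fun t ht => hu t ht.le) hw
  refine measurable_pi_lambda _ fun k => ?_
  rcases k with k | k
  · exact (show Measurable fun x : EuclideanSpace ℝ (Fin nx) => x.ofLp k by fun_prop).comp hx
  · exact (show Measurable fun x : EuclideanSpace ℝ (Fin nu) => x.ofLp k by fun_prop).comp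
      (hu T le_rfl)

end NoiseMeasurability

/-! ### Laws and independence of the regressors. -/

section Trajectories

variable {Ω : Type*} [mΩ : MeasurableSpace Ω] {μ : Measure Ω} {nx nu N : ℕ}

theorem hasLaw_dotProduct_of_isotropic {n : ℕ} {X : Ω → EuclideanSpace ℝ (Fin n)} {σ : ℝ}
    (hX : HasLaw X (multivariateGaussian 0 (σ ^ 2 • 1)) μ) (b : Fin n → ℝ) :
    HasLaw (fun ω => b ⬝ᵥ (X ω).ofLp) (gaussianReal 0 (σ ^ 2 * (b ⬝ᵥ b)).toNNReal) μ := by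
  have hS : (σ ^ 2 • (1 : Matrix (Fin n) (Fin n) ℝ)).PosSemidef :=
    Matrix.PosSemidef.one.smul (sq_nonneg σ)
  set L : EuclideanSpace ℝ (Fin n) →L[ℝ] ℝ := innerSL ℝ (WithLp.toLp 2 b) with hL
  have hLX : (fun ω => b ⬝ᵥ (X ω).ofLp) = L ∘ X := by
    ext ω
    simp [hL, PiLp.inner_apply, dotProduct, mul_comm]
  have hlaw : HasLaw L (gaussianReal 0 (σ ^ 2 * (b ⬝ᵥ b)).toNNReal)
      (multivariateGaussian 0 (σ ^ 2 • 1)) := by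
    refine ⟨by fun_prop, ?_⟩
    rw [IsGaussian.map_eq_gaussianReal]
    congr 1
    · rw [L.integral_comp_id_comm IsGaussian.integrable_id, integral_id_multivariateGaussian,
        map_zero]
    · have h := covarianceBilin_self (μ := multivariateGaussian 0 (σ ^ 2 • 1))
        IsGaussian.memLp_two_id (WithLp.toLp 2 b)
      rw [covarianceBilin_multivariateGaussian hS] at h
      have h2 : Var[L; multivariateGaussian 0 (σ ^ 2 • 1)] = σ ^ 2 * (b ⬝ᵥ b) := by
        rw [hL, ← smul_eq_mul, ← dotProduct_smul]
        simpa [Matrix.smul_mulVec] using h.symm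
      rw [h2]
  rw [hLX]
  exact hlaw.comp hX

variable {u : Fin N → ℕ → Ω → EuclideanSpace ℝ (Fin nu)}
  {w : Fin N → ℕ → Ω → EuclideanSpace ℝ (Fin nx)}

theorem iIndep_noiseSigma (hu_indep : iIndepFun (fun p : Fin N × ℕ => u p.1 p.2) μ)
    (hw_indep : iIndepFun (fun p : Fin N × ℕ => w p.1 p.2) μ)
    (huw_indep : IndepFun (fun ω (p : Fin N × ℕ) => u p.1 p.2 ω)
      (fun ω (p : Fin N × ℕ) => w p.1 p.2 ω) μ) : iIndep (noiseSigma u w) μ :=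
  hu_indep.iIndep.sumElim hw_indep.iIndep
    (indep_of_indep_of_le_left (indep_of_indep_of_le_right huw_indep
      (iSup_comap_le_comap_pi fun p : Fin N × ℕ => w p.1 p.2))
      (iSup_comap_le_comap_pi fun p : Fin N × ℕ => u p.1 p.2))

theorem noiseSigma_le (hu : ∀ i t, Measurable (u i t)) (hw : ∀ i t, Measurable (w i t))
    (k : (Fin N × ℕ) ⊕ (Fin N × ℕ)) : noiseSigma u w k ≤ mΩ := by
  rcases k with p | p
  · exact (hu p.1 p.2).comap_le
  · exact (hw p.1 p.2).comap_le

theorem indepFun_of_disjoint_noise (hind : iIndep (noiseSigma u w) μ)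
    (hu : ∀ i t, Measurable (u i t)) (hw : ∀ i t, Measurable (w i t))
    {S T : Set ((Fin N × ℕ) ⊕ (Fin N × ℕ))} (hST : Disjoint S T) {α β : Type*}
    [MeasurableSpace α] [MeasurableSpace β] {f : Ω → α} {g : Ω → β}
    (hf : Measurable[⨆ k ∈ S, noiseSigma u w k] f)
    (hg : Measurable[⨆ k ∈ T, noiseSigma u w k] g) : IndepFun f g μ := by
  rw [IndepFun_iff_Indep]
  exact indep_of_indep_of_le_left (indep_of_indep_of_le_right
    (indep_iSup_of_disjoint (noiseSigma_le hu hw) hind hST) hg.comap_le) hf.comap_le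

/-- The covariance of the state at time `T`, also for `T = 0`. -/
def stateCovSum (A : Matrix (Fin nx) (Fin nx) ℝ) (B : Matrix (Fin nx) (Fin nu) ℝ)
    (σu σw : ℝ) (T : ℕ) : Matrix (Fin nx) (Fin nx) ℝ :=
  σu ^ 2 • ∑ t ∈ Finset.range T, A ^ t * B * Bᵀ * Aᵀ ^ t +
    σw ^ 2 • ∑ t ∈ Finset.range T, A ^ t * Aᵀ ^ t

theorem stateCov_eq_stateCovSum (A : Matrix (Fin nx) (Fin nx) ℝ) (B : Matrix (Fin nx) (Fin nu) ℝ)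
    (σu σw : ℝ) {T : ℕ} (hT : 1 ≤ T) : stateCov A B σu σw T = stateCovSum A B σu σw T := by
  simp [stateCov, stateCovSum, ctrlGramian, Nat.sub_add_cancel hT]

/-- The terms `t = 0` are `B Bᵀ` and `1`; in the others a factor `A` and a factor `Aᵀ` come out. -/
theorem stateCovSum_succ (A : Matrix (Fin nx) (Fin nx) ℝ) (B : Matrix (Fin nx) (Fin nu) ℝ)
    (σu σw : ℝ) (T : ℕ) : stateCovSum A B σu σw (T + 1) =
      A * stateCovSum A B σu σw T * Aᵀ + σu ^ 2 • (B * Bᵀ) + σw ^ 2 • 1 := by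
  simp only [stateCovSum, Finset.sum_range_succ', pow_zero, mul_one, mul_add, add_mul,
    smul_add, mul_smul_comm, smul_mul_assoc, Finset.mul_sum, Finset.sum_mul]
  have h1 : ∀ t, A ^ (t + 1) * B * Bᵀ * Aᵀ ^ (t + 1) = A * (A ^ t * B * Bᵀ * Aᵀ ^ t) * Aᵀ := by
    intro t
    rw [pow_succ', pow_succ]
    simp only [Matrix.mul_assoc]
  have h2 : ∀ t, A ^ (t + 1) * Aᵀ ^ (t + 1) = A * (A ^ t * Aᵀ ^ t) * Aᵀ := by
    intro t
    rw [pow_succ', pow_succ]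
    simp only [Matrix.mul_assoc]
  simp only [h1, h2, Matrix.one_mul]
  abel

theorem dotProduct_mul_transpose_mulVec {m n : Type*} [Fintype m] [Fintype n] (M : Matrix m n ℝ)
    (a : m → ℝ) : a ⬝ᵥ (M * Mᵀ) *ᵥ a = (Mᵀ *ᵥ a) ⬝ᵥ (Mᵀ *ᵥ a) := by
  rw [← Matrix.mulVec_mulVec, Matrix.dotProduct_mulVec, ← Matrix.mulVec_transpose]

theorem dotProduct_stateCovSum_succ (A : Matrix (Fin nx) (Fin nx) ℝ)
    (B : Matrix (Fin nx) (Fin nu) ℝ) (σu σw : ℝ) (T : ℕ) (a : Fin nx → ℝ) :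
    a ⬝ᵥ stateCovSum A B σu σw (T + 1) *ᵥ a =
      (Aᵀ *ᵥ a) ⬝ᵥ stateCovSum A B σu σw T *ᵥ (Aᵀ *ᵥ a) +
        σu ^ 2 * ((Bᵀ *ᵥ a) ⬝ᵥ (Bᵀ *ᵥ a)) + σw ^ 2 * (a ⬝ᵥ a) := by
  rw [stateCovSum_succ, Matrix.add_mulVec, Matrix.add_mulVec, dotProduct_add, dotProduct_add,
    Matrix.smul_mulVec, Matrix.smul_mulVec, dotProduct_smul, dotProduct_smul,
    dotProduct_mul_transpose_mulVec, Matrix.one_mulVec, Matrix.mul_assoc, ← Matrix.mulVec_mulVec,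
    ← Matrix.mulVec_mulVec, Matrix.dotProduct_mulVec, ← Matrix.mulVec_transpose]
  rfl

theorem dotProduct_stateCovSum_nonneg (A : Matrix (Fin nx) (Fin nx) ℝ)
    (B : Matrix (Fin nx) (Fin nu) ℝ) (σu σw : ℝ) (T : ℕ) (a : Fin nx → ℝ) :
    0 ≤ a ⬝ᵥ stateCovSum A B σu σw T *ᵥ a := by
  induction T generalizing a with
  | zero => simp [stateCovSum]
  | succ T ih =>
    rw [dotProduct_stateCovSum_succ]
    have h1 : 0 ≤ (Bᵀ *ᵥ a) ⬝ᵥ (Bᵀ *ᵥ a) := dotProduct_self_star_nonneg (Bᵀ *ᵥ a)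
    have h2 : 0 ≤ a ⬝ᵥ a := dotProduct_self_star_nonneg a
    have := ih (Aᵀ *ᵥ a)
    positivity

theorem hasLaw_add_gaussianReal {X Y : Ω → ℝ} {a b : ℝ} (ha : 0 ≤ a) (hb : 0 ≤ b)
    (hX : HasLaw X (gaussianReal 0 a.toNNReal) μ) (hY : HasLaw Y (gaussianReal 0 b.toNNReal) μ)
    (h : IndepFun X Y μ) :
    HasLaw (fun ω => X ω + Y ω) (gaussianReal 0 (a + b).toNNReal) μ := by
  refine ⟨hX.aemeasurable.add hY.aemeasurable, ?_⟩
  have := gaussianReal_add_gaussianReal_of_indepFun h hX.map_eq hY.map_eq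
  rwa [add_zero, ← Real.toNNReal_add ha hb] at this

variable {σu σw : ℝ}

/-- Induction on `T`. Including the current input in the statement makes the hypothesis at `T`,
applied to `Aᵀ a` and `Bᵀ a`, cover everything in the next state except the fresh noise. -/
theorem hasLaw_dotProduct_ltiState (hind : iIndep (noiseSigma u w) μ)
    (hu : ∀ i t, Measurable (u i t)) (hw : ∀ i t, Measurable (w i t))
    (hu_law : ∀ i t, HasLaw (u i t) (multivariateGaussian 0 (σu ^ 2 • 1)) μ)
    (hw_law : ∀ i t, HasLaw (w i t) (multivariateGaussian 0 (σw ^ 2 • 1)) μ)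
    (A : Matrix (Fin nx) (Fin nx) ℝ) (B : Matrix (Fin nx) (Fin nu) ℝ) (i : Fin N) (T : ℕ)
    (a : Fin nx → ℝ) (b : Fin nu → ℝ) :
    HasLaw (fun ω => a ⬝ᵥ (ltiState A B (fun t => u i t ω) (fun t => w i t ω) T).ofLp +
        b ⬝ᵥ (u i T ω).ofLp)
      (gaussianReal 0
        (a ⬝ᵥ stateCovSum A B σu σw T *ᵥ a + σu ^ 2 * (b ⬝ᵥ b)).toNNReal) μ := by
  have := hind.isProbabilityMeasure
  have hsq : ∀ {n : ℕ} (c : Fin n → ℝ), 0 ≤ c ⬝ᵥ c := fun c => dotProduct_self_star_nonneg c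
  induction T generalizing a b with
  | zero =>
    simp only [ltiState, stateCovSum]
    simpa using hasLaw_dotProduct_of_isotropic (hu_law i 0) b
  | succ T ih =>
    have hpast : ∀ t < T + 1, (Sum.inl (i, t) : (Fin N × ℕ) ⊕ (Fin N × ℕ)) ∈
        {k | k ≠ Sum.inl (i, T + 1)} := fun t ht => by simpa using ht.ne
    have hx : HasLaw (fun ω => a ⬝ᵥ
        (ltiState A B (fun t => u i t ω) (fun t => w i t ω) (T + 1)).ofLp)
        (gaussianReal 0 (a ⬝ᵥ stateCovSum A B σu σw (T + 1) *ᵥ a).toNNReal) μ := by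
      have hrec : (fun ω => a ⬝ᵥ
          (ltiState A B (fun t => u i t ω) (fun t => w i t ω) (T + 1)).ofLp) = fun ω =>
          ((Aᵀ *ᵥ a) ⬝ᵥ (ltiState A B (fun t => u i t ω) (fun t => w i t ω) T).ofLp +
            (Bᵀ *ᵥ a) ⬝ᵥ (u i T ω).ofLp) + a ⬝ᵥ (w i T ω).ofLp := by
        ext ω
        simp only [ltiState, WithLp.ofLp_add, Matrix.ofLp_toLpLin, Matrix.toLin'_apply, dotProduct_add,
          Matrix.dotProduct_mulVec, Matrix.mulVec_transpose]
      rw [hrec, dotProduct_stateCovSum_succ]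
      refine hasLaw_add_gaussianReal ?_ (mul_nonneg (sq_nonneg _) (hsq _)) (ih _ _)
        (hasLaw_dotProduct_of_isotropic (hw_law i T) a) ?_
      · exact add_nonneg (dotProduct_stateCovSum_nonneg _ _ _ _ _ _)
          (mul_nonneg (sq_nonneg _) (hsq _))
      -- The state and input at time `T` do not involve the noise with index `(i, T)`.
      · refine indepFun_of_disjoint_noise hind hu hw
          (S := {Sum.inr (i, T)}ᶜ) (T := {Sum.inr (i, T)}) disjoint_compl_left
          (Measurable.add (measurable_dotProduct_const (measurable_ltiState A B
            (fun t _ => measurable_input_of_mem (by simp))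
            (fun t ht => measurable_noise_of_mem (by simpa using ht.ne))) _)
            (measurable_dotProduct_const (measurable_input_of_mem (by simp)) _))
          (measurable_dotProduct_const (measurable_noise_of_mem (by simp)) _)
    refine hasLaw_add_gaussianReal (dotProduct_stateCovSum_nonneg _ _ _ _ _ _)
      (mul_nonneg (sq_nonneg _) (hsq _)) hx
      (hasLaw_dotProduct_of_isotropic (hu_law i (T + 1)) b) ?_
    exact indepFun_of_disjoint_noise hind hu hw
      (S := {Sum.inl (i, T + 1)}ᶜ) (T := {Sum.inl (i, T + 1)}) disjoint_compl_left
      (measurable_dotProduct_const (measurable_ltiState A B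
        (fun t ht => measurable_input_of_mem (by simpa using ht.ne))
        (fun t _ => measurable_noise_of_mem (by simp))) _)
      (measurable_dotProduct_const (measurable_input_of_mem (by simp)) _)

theorem hasLaw_dotProduct_regressor (hind : iIndep (noiseSigma u w) μ)
    (hu : ∀ i t, Measurable (u i t)) (hw : ∀ i t, Measurable (w i t))
    (hu_law : ∀ i t, HasLaw (u i t) (multivariateGaussian 0 (σu ^ 2 • 1)) μ)
    (hw_law : ∀ i t, HasLaw (w i t) (multivariateGaussian 0 (σw ^ 2 • 1)) μ)
    (A : Matrix (Fin nx) (Fin nx) ℝ) (B : Matrix (Fin nx) (Fin nu) ℝ) (i : Fin N) (T : ℕ)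
    (c : Fin nx ⊕ Fin nu → ℝ) :
    HasLaw (fun ω => c ⬝ᵥ regressor A B T (fun t => u i t ω) (fun t => w i t ω))
      (gaussianReal 0 (c ⬝ᵥ (Matrix.fromBlocks (stateCovSum A B σu σw T) 0 0
        (σu ^ 2 • 1)) *ᵥ c).toNNReal) μ := by
  have h := hasLaw_dotProduct_ltiState hind hu hw hu_law hw_law A B i T (c ∘ Sum.inl)
    (c ∘ Sum.inr)
  have e1 : ∀ v : Fin nx ⊕ Fin nu → ℝ,
      c ⬝ᵥ v = (c ∘ Sum.inl) ⬝ᵥ (v ∘ Sum.inl) + (c ∘ Sum.inr) ⬝ᵥ (v ∘ Sum.inr) := fun v => by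
    simp [dotProduct, Fintype.sum_sum_type]
  rw [e1, Matrix.fromBlocks_mulVec]
  simp only [e1, regressor, Sum.elim_comp_inl, Sum.elim_comp_inr]
  simpa [Matrix.smul_mulVec] using h

/-- Grouping the σ-algebras by experiment separates the regressors. -/
theorem iIndepFun_dotProduct_regressor (hind : iIndep (noiseSigma u w) μ)
    (hu : ∀ i t, Measurable (u i t)) (hw : ∀ i t, Measurable (w i t))
    (A : Matrix (Fin nx) (Fin nx) ℝ) (B : Matrix (Fin nx) (Fin nu) ℝ) (T : ℕ)
    (c : Fin nx ⊕ Fin nu → ℝ) :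
    iIndepFun (fun i ω => c ⬝ᵥ regressor A B T (fun t => u i t ω) (fun t => w i t ω)) μ := by
  have h := hind.iSup_fiber (noiseSigma_le hu hw)
    (Sum.elim Prod.fst Prod.fst : (Fin N × ℕ) ⊕ (Fin N × ℕ) → Fin N)
  have h' : iIndepFun (fun i ω => regressor A B T (fun t => u i t ω) (fun t => w i t ω)) μ := by
    rw [iIndepFun_iff_iIndep]
    refine iIndep_of_iIndep_of_le h fun i => Measurable.comap_le ?_
    exact measurable_regressor A B (fun t _ => measurable_input_of_mem (by simp))
      (fun t _ => measurable_noise_of_mem (by simp))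
  exact h'.comp (fun _ v => c ⬝ᵥ v) fun _ => by unfold dotProduct; fun_prop

/-- Regressors use noises only at times before `T`, so all noises at time `T`, over all experiments
jointly, can be split off. -/
theorem indepFun_regressor_noise (hind : iIndep (noiseSigma u w) μ)
    (hu : ∀ i t, Measurable (u i t)) (hw : ∀ i t, Measurable (w i t))
    (A : Matrix (Fin nx) (Fin nx) ℝ) (B : Matrix (Fin nx) (Fin nu) ℝ) (T : ℕ) :
    IndepFun (fun ω i => regressor A B T (fun t => u i t ω) (fun t => w i t ω))
      (fun ω i => w i T ω) μ := by
  refine indepFun_of_disjoint_noise hind hu hw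
    (S := {k | ∀ i, k ≠ Sum.inr (i, T)}) (T := {k | ∃ i, k = Sum.inr (i, T)}) ?_ ?_ ?_
  · rw [Set.disjoint_left]
    rintro k hk ⟨i, hi⟩
    exact hk i hi
  · refine @measurable_pi_lambda _ _ _ (_) _ _ fun i => measurable_regressor A B
      (fun t _ => measurable_input_of_mem (by simp))
      (fun t ht => measurable_noise_of_mem fun j hj => ?_)
    simp only [Sum.inr.injEq, Prod.mk.injEq] at hj
    exact ht.ne hj.2
  · exact @measurable_pi_lambda _ _ _ (_) _ _ fun i => measurable_noise_of_mem ⟨i, rfl⟩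

end Trajectories

/-! ### Algebra of the least-squares solution. -/

section LeastSquares

open Matrix

variable {ι m : Type*} [Fintype ι] [DecidableEq ι] [Fintype m] {N : ℕ}

/-- The least-squares solution splits the loss orthogonally. -/
theorem sum_sq_sub_mul_eq (Z : Matrix (Fin N) ι ℝ) (Y : Matrix (Fin N) m ℝ)
    (hD : IsUnit (Zᵀ * Z).det) (Θ : Matrix ι m ℝ) :
    ∑ i, ∑ k, (Y - Z * Θ) i k ^ 2 =
      ∑ i, ∑ k, (Y - Z * ((Zᵀ * Z)⁻¹ * Zᵀ * Y)) i k ^ 2 +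
        ∑ i, ∑ k, (Z * (Θ - (Zᵀ * Z)⁻¹ * Zᵀ * Y)) i k ^ 2 := by
  set Θ₀ := (Zᵀ * Z)⁻¹ * Zᵀ * Y with hΘ₀
  set R := Y - Z * Θ₀ with hR
  -- The normal equations: the residual is orthogonal to the columns of `Z`, which kills the cross
  -- term.
  have hnormal : Zᵀ * R = 0 := by
    rw [hR, hΘ₀, Matrix.mul_sub, ← Matrix.mul_assoc Zᵀ Z, Matrix.mul_assoc _ Zᵀ Y,
      Matrix.mul_nonsing_inv_cancel_left _ _ hD, sub_self]
  have hcross : ∑ i, ∑ k, R i k * (Z * (Θ - Θ₀)) i k = 0 := by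
    have h : ∑ i, ∑ k, R i k * (Z * (Θ - Θ₀)) i k = trace (Rᵀ * (Z * (Θ - Θ₀))) := by
      simp only [trace, diag, Matrix.mul_apply, transpose_apply]
      rw [Finset.sum_comm]
    have h' : Rᵀ * Z = 0 := by
      rw [← Matrix.transpose_transpose (Rᵀ * Z), Matrix.transpose_mul, Matrix.transpose_transpose,
        hnormal, Matrix.transpose_zero]
    rw [h, ← Matrix.mul_assoc, h', Matrix.zero_mul, trace_zero]
  have hsplit : Y - Z * Θ = R - Z * (Θ - Θ₀) := by
    rw [hR, Matrix.mul_sub]; abel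
  have hexp : ∀ i k, (Y - Z * Θ) i k ^ 2 = R i k ^ 2 + (Z * (Θ - Θ₀)) i k ^ 2
      - 2 * (R i k * (Z * (Θ - Θ₀)) i k) := by
    intro i k
    rw [hsplit, Matrix.sub_apply]; ring
  simp only [hexp, Finset.sum_sub_distrib, Finset.sum_add_distrib, ← Finset.mul_sum, hcross]
  ring

/-- Equal loss forces `Z (Θ - Θ₀) = 0` for the closed-form solution `Θ₀`, and an invertible Gram
matrix makes `Z` injective. -/
theorem minimizes_sum_sq_iff (Z : Matrix (Fin N) ι ℝ) (Y : Matrix (Fin N) m ℝ)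
    (hD : IsUnit (Zᵀ * Z).det) (Θ : Matrix ι m ℝ) :
    (∀ Θ' : Matrix ι m ℝ, ∑ i, ∑ k, (Y - Z * Θ) i k ^ 2 ≤ ∑ i, ∑ k, (Y - Z * Θ') i k ^ 2) ↔
      Θ = (Zᵀ * Z)⁻¹ * Zᵀ * Y := by
  constructor
  · intro h
    have h1 := h ((Zᵀ * Z)⁻¹ * Zᵀ * Y)
    rw [sum_sq_sub_mul_eq Z Y hD Θ] at h1
    have h0 : ∑ i, ∑ k, (Z * (Θ - (Zᵀ * Z)⁻¹ * Zᵀ * Y)) i k ^ 2 = 0 :=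
      le_antisymm (by linarith)
        (Finset.sum_nonneg fun i _ => Finset.sum_nonneg fun k _ => sq_nonneg _)
    have hz : Z * (Θ - (Zᵀ * Z)⁻¹ * Zᵀ * Y) = 0 := by
      ext i k
      have h2 := (Finset.sum_eq_zero_iff_of_nonneg
        (fun i _ => Finset.sum_nonneg fun k _ => sq_nonneg _)).1 h0 i (Finset.mem_univ _)
      have h3 := (Finset.sum_eq_zero_iff_of_nonneg (fun k _ => sq_nonneg _)).1 h2 k
        (Finset.mem_univ _)
      exact (pow_eq_zero_iff two_ne_zero).1 h3
    have := congrArg (fun M => (Zᵀ * Z)⁻¹ * (Zᵀ * M)) hz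
    simp only [← Matrix.mul_assoc Zᵀ Z, Matrix.nonsing_inv_mul_cancel_left _ _ hD,
      Matrix.mul_zero] at this
    exact sub_eq_zero.1 this
  · rintro rfl Θ'
    rw [sum_sq_sub_mul_eq Z Y hD Θ']
    exact le_add_of_nonneg_right
      (Finset.sum_nonneg fun i _ => Finset.sum_nonneg fun k _ => sq_nonneg _)

/-- The weights with which the noises enter the least-squares error in direction `c`. -/
noncomputable def olsWeight (Z : Matrix (Fin N) ι ℝ) (c : ι → ℝ) : Fin N → ℝ :=
  c ᵥ* ((Zᵀ * Z)⁻¹ * Zᵀ)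

/-- With `e = (Zᵀ Z)⁻¹ c`, the sum is `Q = c ⬝ᵥ e`, and also `∑ (e ⬝ᵥ Z i)²`. Hence `κ Q² ≤ κ K q(e)
≤ K Q`, and dividing by `Q` avoids inverting matrix inequalities. -/
theorem sum_sq_olsWeight_le (Z : Matrix (Fin N) ι ℝ) (hD : IsUnit (Zᵀ * Z).det) (c : ι → ℝ)
    {q : (ι → ℝ) → ℝ} {κ K : ℝ} (hκ : 0 < κ) (hK : 0 ≤ K)
    (hq : ∀ e, κ * q e ≤ ∑ i, (e ⬝ᵥ Z i) ^ 2) (hc : ∀ e, (c ⬝ᵥ e) ^ 2 ≤ K * q e) :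
    ∑ i, olsWeight Z c i ^ 2 ≤ K / κ := by
  set e := c ᵥ* (Zᵀ * Z)⁻¹ with he
  have hw : ∀ i, olsWeight Z c i = e ⬝ᵥ Z i := by
    intro i
    rw [olsWeight, ← Matrix.vecMul_vecMul]
    rfl
  have hsum : ∑ i, (e ⬝ᵥ Z i) ^ 2 = c ⬝ᵥ e := by
    have h1 : ∑ i, (e ⬝ᵥ Z i) ^ 2 = (e ᵥ* Zᵀ) ⬝ᵥ (e ᵥ* Zᵀ) := by
      simp only [dotProduct, sq]; rfl
    rw [h1, ← Matrix.dotProduct_mulVec, Matrix.vecMul_transpose, Matrix.mulVec_mulVec,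
      Matrix.dotProduct_mulVec, he, Matrix.vecMul_vecMul,
      Matrix.nonsing_inv_mul _ hD, Matrix.vecMul_one]
  simp only [hw]
  have h1 := hq e
  have h2 := hc e
  rw [hsum] at h1 ⊢
  set Q := c ⬝ᵥ e
  have hQ : 0 ≤ Q := hsum ▸ Finset.sum_nonneg fun i _ => sq_nonneg _
  rw [le_div_iff₀ hκ]
  rcases hQ.eq_or_lt with h0 | h0
  · rw [← h0, zero_mul]; exact hK
  · have : Q * (Q * κ) ≤ Q * K := by
      calc Q * (Q * κ) = κ * Q ^ 2 := by ring
        _ ≤ κ * (K * q e) := by gcongr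
        _ = K * (κ * q e) := by ring
        _ ≤ K * Q := by gcongr
        _ = Q * K := by ring
    exact le_of_mul_le_mul_left this h0

theorem isUnit_det_of_quadratic_le (Z : Matrix (Fin N) ι ℝ) {S : Matrix ι ι ℝ} (hS : S.PosDef)
    {κ : ℝ} (hκ : 0 < κ) (hq : ∀ e, κ * (e ⬝ᵥ S *ᵥ e) ≤ ∑ i, (e ⬝ᵥ Z i) ^ 2) :
    IsUnit (Zᵀ * Z).det := by
  rw [← Matrix.isUnit_iff_isUnit_det, ← Matrix.mulVec_injective_iff_isUnit]
  rw [← Matrix.coe_mulVecLin, ← LinearMap.ker_eq_bot, LinearMap.ker_eq_bot']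
  intro e he
  rw [Matrix.mulVecLin_apply] at he
  by_contra hne
  have h1 := hS.dotProduct_mulVec_pos hne
  have h2 : ∑ i, (e ⬝ᵥ Z i) ^ 2 = e ⬝ᵥ (Zᵀ * Z) *ᵥ e := by
    rw [← Matrix.mulVec_mulVec, Matrix.dotProduct_mulVec, Matrix.vecMul_transpose]
    simp only [dotProduct, sq, Matrix.mulVec, mul_comm]
  have h3 := hq e
  rw [h2, he, dotProduct_zero] at h3
  rw [star_trivial] at h1
  have : 0 < κ * (e ⬝ᵥ S *ᵥ e) := mul_pos hκ h1
  linarith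

variable {nx nu : ℕ}

theorem lsLoss_eq_sum_sq (x : Fin N → EuclideanSpace ℝ (Fin nx))
    (v : Fin N → EuclideanSpace ℝ (Fin nu)) (y : Fin N → EuclideanSpace ℝ (Fin nx))
    (P : Matrix (Fin nx) (Fin nx) ℝ × Matrix (Fin nx) (Fin nu) ℝ) :
    lsLoss x v y P = ∑ i, ∑ k, ((Matrix.of fun i => (y i).ofLp) -
      (Matrix.of fun i => Sum.elim (x i).ofLp (v i).ofLp) * fromRows P.1ᵀ P.2ᵀ :
        Matrix (Fin N) (Fin nx) ℝ) i k ^ 2 := by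
  unfold lsLoss
  refine Finset.sum_congr rfl fun i _ => ?_
  rw [EuclideanSpace.real_norm_sq_eq]
  refine Finset.sum_congr rfl fun k _ => ?_
  simp only [PiLp.sub_apply, Matrix.sub_apply, Matrix.of_apply, Matrix.mul_apply,
    Fintype.sum_sum_type, Sum.elim_inl, Sum.elim_inr, fromRows_apply_inl, fromRows_apply_inr,
    Matrix.transpose_apply, Matrix.ofLp_toLpLin, Matrix.toLin'_apply, Matrix.mulVec, dotProduct]
  simp only [mul_comm]
  ring

theorem isLeastSquares_iff (x : Fin N → EuclideanSpace ℝ (Fin nx))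
    (v : Fin N → EuclideanSpace ℝ (Fin nu)) (y : Fin N → EuclideanSpace ℝ (Fin nx))
    (P : Matrix (Fin nx) (Fin nx) ℝ × Matrix (Fin nx) (Fin nu) ℝ)
    {Z : Matrix (Fin N) (Fin nx ⊕ Fin nu) ℝ}
    (hZ : Z = Matrix.of fun i => Sum.elim (x i).ofLp (v i).ofLp)
    (hD : IsUnit (Zᵀ * Z).det) :
    IsLeastSquares x v y P ↔
      fromRows P.1ᵀ P.2ᵀ = (Zᵀ * Z)⁻¹ * Zᵀ * Matrix.of fun i => (y i).ofLp := by
  rw [← minimizes_sum_sq_iff Z _ hD, IsLeastSquares]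
  simp only [lsLoss_eq_sum_sq, ← hZ]
  refine ⟨fun h Θ => ?_, fun h Q => h _⟩
  have := h (Θ.toRows₁ᵀ, Θ.toRows₂ᵀ)
  simpa using this

theorem existsUnique_isLeastSquares (x : Fin N → EuclideanSpace ℝ (Fin nx))
    (v : Fin N → EuclideanSpace ℝ (Fin nu)) (y : Fin N → EuclideanSpace ℝ (Fin nx))
    {Z : Matrix (Fin N) (Fin nx ⊕ Fin nu) ℝ}
    (hZ : Z = Matrix.of fun i => Sum.elim (x i).ofLp (v i).ofLp)
    (hD : IsUnit (Zᵀ * Z).det) : ∃! P, IsLeastSquares x v y P := by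
  simp only [isLeastSquares_iff x v y _ hZ hD]
  set Θ := (Zᵀ * Z)⁻¹ * Zᵀ * Matrix.of fun i => (y i).ofLp
  refine ⟨(Θ.toRows₁ᵀ, Θ.toRows₂ᵀ), by simp, fun P hP => ?_⟩
  simp only at hP
  rw [← hP]
  simp

/-- The error of the least-squares estimate is a weighted sum of the noises. -/
theorem dotProduct_error_of_isLeastSquares {A : Matrix (Fin nx) (Fin nx) ℝ}
    {B : Matrix (Fin nx) (Fin nu) ℝ} {x : Fin N → EuclideanSpace ℝ (Fin nx)}
    {v : Fin N → EuclideanSpace ℝ (Fin nu)} {w : Fin N → EuclideanSpace ℝ (Fin nx)}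
    {P : Matrix (Fin nx) (Fin nx) ℝ × Matrix (Fin nx) (Fin nu) ℝ}
    {Z : Matrix (Fin N) (Fin nx ⊕ Fin nu) ℝ}
    (hZ : Z = Matrix.of fun i => Sum.elim (x i).ofLp (v i).ofLp)
    (hD : IsUnit (Zᵀ * Z).det)
    (hP : IsLeastSquares x v
      (fun i => Matrix.toEuclideanLin A (x i) + Matrix.toEuclideanLin B (v i) + w i) P)
    (a : Fin nx → ℝ) (c : Fin nx ⊕ Fin nu → ℝ) :
    a ⬝ᵥ ((P.1 - A) *ᵥ (c ∘ Sum.inl) + (P.2 - B) *ᵥ (c ∘ Sum.inr)) =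
      ∑ i, olsWeight Z c i * (a ⬝ᵥ (w i).ofLp) := by
  rw [isLeastSquares_iff x v _ P hZ hD] at hP
  set W : Matrix (Fin N) (Fin nx) ℝ := Matrix.of fun i => (w i).ofLp with hW
  have hY : (Matrix.of fun i => (Matrix.toEuclideanLin A (x i) +
      Matrix.toEuclideanLin B (v i) + w i).ofLp) = Z * fromRows Aᵀ Bᵀ + W := by
    ext i k
    simp only [hZ, hW, Matrix.add_apply, Matrix.of_apply, Matrix.mul_apply, PiLp.add_apply,
      Fintype.sum_sum_type, Sum.elim_inl, Sum.elim_inr, fromRows_apply_inl, fromRows_apply_inr,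
      Matrix.transpose_apply, Matrix.ofLp_toLpLin, Matrix.toLin'_apply, Matrix.mulVec, dotProduct]
    simp only [mul_comm]
  have hE : fromRows P.1ᵀ P.2ᵀ - fromRows Aᵀ Bᵀ = (Zᵀ * Z)⁻¹ * Zᵀ * W := by
    rw [hP, hY, Matrix.mul_add, Matrix.mul_assoc _ Zᵀ (Z * _), ← Matrix.mul_assoc Zᵀ Z,
      Matrix.nonsing_inv_mul_cancel_left _ _ hD, add_sub_cancel_left]
  have h1 : (P.1 - A) *ᵥ (c ∘ Sum.inl) + (P.2 - B) *ᵥ (c ∘ Sum.inr) =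
      c ᵥ* (fromRows P.1ᵀ P.2ᵀ - fromRows Aᵀ Bᵀ) := by
    rw [Matrix.vecMul_sub]
    conv_rhs => rw [← Sum.elim_comp_inl_inr c]
    rw [Matrix.sumElim_vecMul_fromRows, Matrix.sumElim_vecMul_fromRows]
    simp only [Matrix.vecMul_transpose, Matrix.sub_mulVec]
    abel
  rw [h1, hE, ← Matrix.vecMul_vecMul, dotProduct_comm, ← Matrix.dotProduct_mulVec]
  simp only [dotProduct, olsWeight, Matrix.mulVec, hW, Matrix.of_apply, mul_comm]

end LeastSquares

/-! ### Smallest eigenvalue and positive definiteness. -/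

section StateCovariance

theorem minEigenvalue_mul_le {n : ℕ} {M : Matrix (Fin n) (Fin n) ℝ} (hM : M.IsHermitian)
    (a : Fin n → ℝ) : minEigenvalue M * (a ⬝ᵥ a) ≤ a ⬝ᵥ M *ᵥ a := by
  open scoped MatrixOrder ComplexOrder in
  have hle : algebraMap ℝ (Matrix (Fin n) (Fin n) ℝ) (minEigenvalue M) ≤ M := by
    rw [algebraMap_le_iff_le_spectrum (a := M) (ha := hM)]
    intro x hx
    refine csInf_le ?_ hx
    rw [hM.spectrum_real_eq_range_eigenvalues]
    exact (Set.finite_range _).bddBelow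
  have h := (Matrix.le_iff.1 hle).dotProduct_mulVec_nonneg a
  rw [star_trivial, Matrix.sub_mulVec, dotProduct_sub, Algebra.algebraMap_eq_smul_one,
    Matrix.smul_mulVec, Matrix.one_mulVec, dotProduct_smul, smul_eq_mul] at h
  linarith

/-- Dimension zero is excluded because the spectrum is then empty and its `sInf` is zero. -/
theorem minEigenvalue_pos {n : ℕ} [NeZero n] {M : Matrix (Fin n) (Fin n) ℝ} (hM : M.PosDef) :
    0 < minEigenvalue M := by
  have hne : (spectrum ℝ M).Nonempty := by
    rw [hM.1.spectrum_real_eq_range_eigenvalues]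
    exact Set.range_nonempty _
  have hfin : (spectrum ℝ M).Finite := by
    rw [hM.1.spectrum_real_eq_range_eigenvalues]
    exact Set.finite_range _
  have hmem := hne.csInf_mem hfin
  rw [hM.1.spectrum_real_eq_range_eigenvalues] at hmem
  obtain ⟨i, hi⟩ := hmem
  rw [minEigenvalue, hM.1.spectrum_real_eq_range_eigenvalues, ← hi]
  exact hM.eigenvalues_pos i

variable {nx nu : ℕ}

theorem isHermitian_stateCovSum (A : Matrix (Fin nx) (Fin nx) ℝ)
    (B : Matrix (Fin nx) (Fin nu) ℝ) (σu σw : ℝ) (T : ℕ) :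
    (stateCovSum A B σu σw T).IsHermitian := by
  rw [Matrix.IsHermitian, Matrix.conjTranspose_eq_transpose_of_trivial]
  simp [stateCovSum, Matrix.transpose_sum, Matrix.transpose_mul, Matrix.transpose_pow,
    Matrix.mul_assoc]

/-- The most recent noise alone contributes `σw² I`. -/
theorem posDef_stateCovSum (A : Matrix (Fin nx) (Fin nx) ℝ) (B : Matrix (Fin nx) (Fin nu) ℝ)
    (σu : ℝ) {σw : ℝ} (hσw : 0 < σw) {T : ℕ} (hT : 1 ≤ T) :
    (stateCovSum A B σu σw T).PosDef := by
  refine Matrix.PosDef.of_dotProduct_mulVec_pos (isHermitian_stateCovSum _ _ _ _ _) fun a ha => ?_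
  obtain ⟨T, rfl⟩ := Nat.exists_eq_add_of_le' hT
  rw [star_trivial, dotProduct_stateCovSum_succ]
  have h1 : 0 ≤ (Bᵀ *ᵥ a) ⬝ᵥ (Bᵀ *ᵥ a) := dotProduct_self_star_nonneg (Bᵀ *ᵥ a)
  have h2 : 0 < a ⬝ᵥ a := Matrix.dotProduct_self_star_pos_iff.2 ha
  have h3 := dotProduct_stateCovSum_nonneg A B σu σw T (Aᵀ *ᵥ a)
  positivity

theorem dotProduct_fromBlocks_mulVec (G : Matrix (Fin nx) (Fin nx) ℝ) (s : ℝ)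
    (e : Fin nx ⊕ Fin nu → ℝ) :
    e ⬝ᵥ (Matrix.fromBlocks G 0 0 (s • (1 : Matrix (Fin nu) (Fin nu) ℝ))) *ᵥ e =
      (e ∘ Sum.inl) ⬝ᵥ G *ᵥ (e ∘ Sum.inl) + s * ((e ∘ Sum.inr) ⬝ᵥ (e ∘ Sum.inr)) := by
  rw [Matrix.fromBlocks_mulVec]
  simp [dotProduct, Fintype.sum_sum_type, Matrix.smul_mulVec, Finset.mul_sum, mul_left_comm]

theorem posDef_fromBlocks_smul_one {G : Matrix (Fin nx) (Fin nx) ℝ} (hG : G.PosDef) {s : ℝ}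
    (hs : 0 < s) :
    (Matrix.fromBlocks G 0 0 (s • (1 : Matrix (Fin nu) (Fin nu) ℝ))).PosDef := by
  refine Matrix.PosDef.of_dotProduct_mulVec_pos ?_ fun e he => ?_
  · refine Matrix.IsHermitian.fromBlocks hG.1 (by simp) ?_
    simp [Matrix.IsHermitian]
  · rw [star_trivial, dotProduct_fromBlocks_mulVec]
    have h2 : 0 ≤ (e ∘ Sum.inr) ⬝ᵥ (e ∘ Sum.inr) := dotProduct_self_star_nonneg (e ∘ Sum.inr)
    by_cases h1 : e ∘ Sum.inl = 0
    · have h3 : e ∘ Sum.inr ≠ 0 := fun h3 => he (by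
        rw [← Sum.elim_comp_inl_inr e, h1, h3]; ext (k | k) <;> rfl)
      have h4 : 0 < (e ∘ Sum.inr) ⬝ᵥ (e ∘ Sum.inr) := Matrix.dotProduct_self_star_pos_iff.2 h3
      rw [h1, zero_dotProduct]
      positivity
    · have h5 := hG.dotProduct_mulVec_pos h1
      rw [star_trivial] at h5
      positivity

theorem norm_le_of_isSphereNet {n k : ℕ} {s : Finset (EuclideanSpace ℝ (Fin k))}
    (hs : IsSphereNet s) {t : Finset (EuclideanSpace ℝ (Fin n))} (ht : IsSphereNet t)
    (M : Matrix (Fin n) (Fin k) ℝ) {K : ℝ} (hK : 0 ≤ K)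
    (h : ∀ a ∈ t, ∀ b ∈ s, a.ofLp ⬝ᵥ M *ᵥ b.ofLp ≤ K) : ‖M‖ ≤ 4 / 3 * K := by
  rw [Matrix.l2_opNorm_def]
  refine opNorm_le_of_isSphereNet_inner hs ht _ hK fun a ha b hb => ?_
  refine le_trans (le_of_eq ?_) (h a ha b hb)
  simp [PiLp.inner_apply, dotProduct, mul_comm]

end StateCovariance

/-! ### Tails of the noise with random weights. -/

section NoiseTail

open Matrix

variable {Ω : Type*} [MeasurableSpace Ω] {μ : Measure Ω}

/-- Writing the inverse through determinant and adjugate gives measurability on all samples,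
including those with singular Gram matrix. -/
theorem measurable_olsWeight {ι : Type*} [Fintype ι] [DecidableEq ι] {N : ℕ} (c : ι → ℝ)
    (i : Fin N) : Measurable fun z : Fin N → ι → ℝ => olsWeight (Matrix.of z) c i := by
  have hgram : Continuous fun z : Fin N → ι → ℝ => (Matrix.of z)ᵀ * Matrix.of z := by
    refine continuous_matrix fun j k => ?_
    simp only [Matrix.mul_apply, Matrix.transpose_apply, Matrix.of_apply]
    fun_prop
  have hinv : ∀ j k, Measurable fun z : Fin N → ι → ℝ =>
      ((Matrix.of z)ᵀ * Matrix.of z)⁻¹ j k := fun j k => by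
    simp only [Matrix.inv_def, Ring.inverse_eq_inv', Matrix.smul_apply, smul_eq_mul]
    exact hgram.matrix_det.measurable.inv.mul (hgram.matrix_adjugate.matrix_elem j k).measurable
  have h : ∀ z : Fin N → ι → ℝ, olsWeight (Matrix.of z) c i =
      ∑ j, c j * ∑ k, ((Matrix.of z)ᵀ * Matrix.of z)⁻¹ j k * z i k := fun z => by
    simp only [olsWeight, Matrix.vecMul, dotProduct]
    refine Finset.sum_congr rfl fun j _ => ?_
    rw [Matrix.mul_apply]
    simp only [Matrix.transpose_apply, Matrix.of_apply]
  simp only [h]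
  exact Finset.measurable_sum _ fun j _ => (Finset.measurable_sum _ fun k _ =>
    (hinv j k).mul ((measurable_pi_apply k).comp (measurable_pi_apply i))).const_mul (c j)

/-- The weight bound is part of the event, so each section in `z` is either a Gaussian tail with
fixed weights or empty, and no conditioning on a good event is needed. -/
theorem measureReal_olsWeight_tail {ι : Type*} [Fintype ι] [DecidableEq ι] {N n : ℕ}
    {z : Fin N → Ω → ι → ℝ} {w : Fin N → Ω → EuclideanSpace ℝ (Fin n)} {σw : ℝ}
    (hz : ∀ i, Measurable (z i)) (hw : ∀ i, Measurable (w i))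
    (hzw : IndepFun (fun ω i => z i ω) (fun ω i => w i ω) μ) (hind : iIndepFun w μ)
    (hlaw : ∀ i, HasLaw (w i) (multivariateGaussian 0 (σw ^ 2 • 1)) μ)
    (c : ι → ℝ) {a : EuclideanSpace ℝ (Fin n)} (ha : ‖a‖ = 1) (K : ℝ) {s : ℝ} (hs : 0 ≤ s) :
    μ.real {ω | ∑ i, olsWeight (Matrix.of fun i => z i ω) c i ^ 2 ≤ K ∧
      s < ∑ i, olsWeight (Matrix.of fun i => z i ω) c i * (a.ofLp ⬝ᵥ (w i ω).ofLp)} ≤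
      Real.exp (-s ^ 2 / (2 * (K * σw ^ 2))) := by
  have := hind.isProbabilityMeasure
  have hm := fun i => measurable_olsWeight (N := N) c i
  have hdot : ∀ i : Fin N, Measurable fun w : Fin N → EuclideanSpace ℝ (Fin n) =>
      a.ofLp ⬝ᵥ (w i).ofLp := fun i => measurable_dotProduct_const (measurable_pi_apply i) _
  have hS : MeasurableSet {p : (Fin N → ι → ℝ) × (Fin N → EuclideanSpace ℝ (Fin n)) |
      ∑ i, olsWeight (Matrix.of p.1) c i ^ 2 ≤ K ∧
      s < ∑ i, olsWeight (Matrix.of p.1) c i * (a.ofLp ⬝ᵥ (p.2 i).ofLp)} := by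
    have h1 : Measurable fun p : (Fin N → ι → ℝ) × (Fin N → EuclideanSpace ℝ (Fin n)) =>
        ∑ i, olsWeight (Matrix.of p.1) c i ^ 2 :=
      Finset.measurable_sum _ fun i _ => ((hm i).comp measurable_fst).pow_const 2
    have h2 : Measurable fun p : (Fin N → ι → ℝ) × (Fin N → EuclideanSpace ℝ (Fin n)) =>
        ∑ i, olsWeight (Matrix.of p.1) c i * (a.ofLp ⬝ᵥ (p.2 i).ofLp) :=
      Finset.measurable_sum _ fun i _ =>
        ((hm i).comp measurable_fst).mul ((hdot i).comp measurable_snd)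
    exact (measurableSet_le h1 measurable_const).inter (measurableSet_lt measurable_const h2)
  refine measureReal_prodMk_mem_le_of_indepFun (measurable_pi_lambda _ hz)
    (measurable_pi_lambda _ hw) hzw hS (Real.exp_pos _).le fun z => ?_
  have hnorm : a.ofLp ⬝ᵥ a.ofLp = 1 := by
    rw [← one_pow 2, ← ha, EuclideanSpace.real_norm_sq_eq]
    simp [dotProduct, sq]
  have hl : ∀ i, HasLaw (fun ω => a.ofLp ⬝ᵥ (w i ω).ofLp)
      (gaussianReal 0 (σw ^ 2).toNNReal) μ := fun i => by
    have := hasLaw_dotProduct_of_isotropic (hlaw i) a.ofLp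
    rwa [hnorm, mul_one] at this
  by_cases hK : ∑ i, olsWeight (Matrix.of z) c i ^ 2 ≤ K
  · have h := measureReal_le_sum_mul_gaussian (hind.comp (fun _ x => a.ofLp ⬝ᵥ x.ofLp)
      fun _ => measurable_dotProduct_const measurable_id _) hl hK hs
    rw [Real.coe_toNNReal _ (sq_nonneg _)] at h
    exact (measureReal_mono (fun ω hω => hω.2.le) (measure_ne_top _ _)).trans h
  · have he : {ω | (z, fun i => w i ω) ∈
        {p : (Fin N → ι → ℝ) × (Fin N → EuclideanSpace ℝ (Fin n)) |
      ∑ i, olsWeight (Matrix.of p.1) c i ^ 2 ≤ K ∧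
      s < ∑ i, olsWeight (Matrix.of p.1) c i * (a.ofLp ⬝ᵥ (p.2 i).ofLp)}} = ∅ := by
      ext ω
      simp [hK]
    rw [he, measureReal_empty]
    exact (Real.exp_pos _).le

/-- Union bound of `measureReal_olsWeight_tail` over two nets. -/
theorem measureReal_iUnion_olsWeight_tail {ι : Type*} [Fintype ι] [DecidableEq ι] {N n k : ℕ}
    {z : Fin N → Ω → ι → ℝ} {w : Fin N → Ω → EuclideanSpace ℝ (Fin n)} {σw : ℝ}
    (hz : ∀ i, Measurable (z i)) (hw : ∀ i, Measurable (w i))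
    (hzw : IndepFun (fun ω i => z i ω) (fun ω i => w i ω) μ) (hind : iIndepFun w μ)
    (hlaw : ∀ i, HasLaw (w i) (multivariateGaussian 0 (σw ^ 2 • 1)) μ)
    (c : EuclideanSpace ℝ (Fin k) → ι → ℝ) {t : Finset (EuclideanSpace ℝ (Fin n))}
    (ht : IsSphereNet t) (ht' : t.card ≤ 17 ^ n) {r : Finset (EuclideanSpace ℝ (Fin k))}
    (hr' : r.card ≤ 17 ^ k) (K : ℝ) {s : ℝ} (hs : 0 ≤ s) :
    μ.real (⋃ a ∈ t, ⋃ b ∈ r,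
      {ω | ∑ i, olsWeight (Matrix.of fun i => z i ω) (c b) i ^ 2 ≤ K ∧
        s < ∑ i, olsWeight (Matrix.of fun i => z i ω) (c b) i * (a.ofLp ⬝ᵥ (w i ω).ofLp)}) ≤
      17 ^ (n + k) * Real.exp (-s ^ 2 / (2 * (K * σw ^ 2))) := by
  refine (measureReal_biUnion_finset_le _ _).trans ?_
  calc _ ≤ ∑ a ∈ t, ∑ b ∈ r, Real.exp (-s ^ 2 / (2 * (K * σw ^ 2))) :=
        Finset.sum_le_sum fun a ha => (measureReal_biUnion_finset_le _ _).trans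
          (Finset.sum_le_sum fun b _ =>
            measureReal_olsWeight_tail hz hw hzw hind hlaw (c b) (ht.1 a ha) K hs)
    _ = (t.card * r.card : ℕ) * Real.exp (-s ^ 2 / (2 * (K * σw ^ 2))) := by
        simp only [Finset.sum_const, nsmul_eq_mul]; push_cast; ring
    _ ≤ (17 ^ n * 17 ^ k : ℕ) * Real.exp (-s ^ 2 / (2 * (K * σw ^ 2))) := by gcongr
    _ = _ := by push_cast; ring

/-- The exponential is `(δ/54)^(2m)`. One factor `δ/54` per dimension absorbs the net factor 17, and
`m ≥ 1` leaves at least one more. -/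
theorem seventeen_pow_mul_exp_le {k m : ℕ} (hk : k ≤ m) (hm : 1 ≤ m) {δ : ℝ} (hδ : 0 < δ)
    (hδ' : δ ≤ 1) : 17 ^ k * Real.exp (-(2 * m * Real.log (54 / δ))) ≤ δ / 54 := by
  have hexp : Real.exp (-(2 * m * Real.log (54 / δ))) = ((δ / 54) ^ 2) ^ m := by
    rw [← Real.exp_log (show 0 < ((δ / 54) ^ 2) ^ m by positivity), Real.log_pow, Real.log_pow,
      ← inv_div 54 δ, Real.log_inv]
    push_cast; ring_nf
  have hr : δ / 54 ≤ 1 / 54 := by gcongr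
  calc 17 ^ k * Real.exp (-(2 * m * Real.log (54 / δ)))
      ≤ 17 ^ m * ((δ / 54) ^ 2) ^ m := by rw [hexp]; gcongr; norm_num
    _ = (17 * (δ / 54) ^ 2) ^ m := by rw [mul_pow]
    _ ≤ (δ / 54) ^ m := by
        gcongr
        nlinarith [div_pos hδ (show (0 : ℝ) < 54 by norm_num)]
    _ ≤ δ / 54 := pow_le_of_le_one (by positivity) (by linarith) (by omega)

end NoiseTail

/-! ### Assembly of the error bounds. -/

section MainTheorem

theorem sq_dotProduct_le {ι : Type*} [Fintype ι] (b e : ι → ℝ) :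
    (b ⬝ᵥ e) ^ 2 ≤ (b ⬝ᵥ b) * (e ⬝ᵥ e) := by
  have := Finset.sum_mul_sq_le_sq_mul_sq Finset.univ b e
  simpa [dotProduct, sq] using this

theorem dotProduct_self_eq_one_of_norm {n : ℕ} {b : EuclideanSpace ℝ (Fin n)} (hb : ‖b‖ = 1) :
    b.ofLp ⬝ᵥ b.ofLp = 1 := by
  rw [← one_pow 2, ← hb, EuclideanSpace.real_norm_sq_eq]
  simp [dotProduct, sq]

variable {Ω : Type*} [MeasurableSpace Ω] {μ : Measure Ω} {nx nu N T : ℕ}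

/-- The unique least-squares estimate exists and satisfies the two error bounds. -/
def EstimateBounds (A : Matrix (Fin nx) (Fin nx) ℝ) (B : Matrix (Fin nx) (Fin nu) ℝ) (T : ℕ)
    (u : Fin N → ℕ → EuclideanSpace ℝ (Fin nu)) (w : Fin N → ℕ → EuclideanSpace ℝ (Fin nx))
    (εA εB : ℝ) : Prop :=
  (∃! P : Matrix (Fin nx) (Fin nx) ℝ × Matrix (Fin nx) (Fin nu) ℝ,
    IsLastStepEstimate A B T u w P) ∧
  ∀ (Ahat : Matrix (Fin nx) (Fin nx) ℝ) (Bhat : Matrix (Fin nx) (Fin nu) ℝ),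
    IsLastStepEstimate A B T u w (Ahat, Bhat) → ‖Ahat - A‖ ≤ εA ∧ ‖Bhat - B‖ ≤ εB

/-- If the empirical covariance dominates `κ S` and the weighted noise sums are small on nets,
then the error bounds hold. -/
theorem estimateBounds_of_nets {A : Matrix (Fin nx) (Fin nx) ℝ} {B : Matrix (Fin nx) (Fin nu) ℝ}
    {u : Fin N → ℕ → EuclideanSpace ℝ (Fin nu)} {w : Fin N → ℕ → EuclideanSpace ℝ (Fin nx)}
    {G : Matrix (Fin nx) (Fin nx) ℝ} (hG : G.PosDef) {lam ρ κ sA sB : ℝ} (hlam : 0 < lam)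
    (hlamG : ∀ a, lam * (a ⬝ᵥ a) ≤ a ⬝ᵥ G *ᵥ a) (hρ : 0 < ρ) (hκ : 0 < κ) (hsA : 0 ≤ sA)
    (hsB : 0 ≤ sB) {t : Finset (EuclideanSpace ℝ (Fin nx))} (ht : IsSphereNet t)
    {r : Finset (EuclideanSpace ℝ (Fin nu))} (hr : IsSphereNet r)
    {Z : Matrix (Fin N) (Fin nx ⊕ Fin nu) ℝ}
    (hZ : Z = Matrix.of fun i => regressor A B T (u i) (w i))
    (hq : ∀ e, κ * (e ⬝ᵥ (Matrix.fromBlocks G 0 0 (ρ • 1)) *ᵥ e) ≤ ∑ i, (e ⬝ᵥ Z i) ^ 2)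
    (hA : ∀ a ∈ t, ∀ b ∈ t, ∑ i, olsWeight Z (Sum.elim b.ofLp 0) i ^ 2 ≤ 1 / lam / κ →
      ∑ i, olsWeight Z (Sum.elim b.ofLp 0) i * (a.ofLp ⬝ᵥ (w i T).ofLp) ≤ sA)
    (hB : ∀ a ∈ t, ∀ b ∈ r, ∑ i, olsWeight Z (Sum.elim 0 b.ofLp) i ^ 2 ≤ 1 / ρ / κ →
      ∑ i, olsWeight Z (Sum.elim 0 b.ofLp) i * (a.ofLp ⬝ᵥ (w i T).ofLp) ≤ sB) :
    EstimateBounds A B T u w (4 / 3 * sA) (4 / 3 * sB) := by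
  have hD : IsUnit (Zᵀ * Z).det :=
    isUnit_det_of_quadratic_le Z (posDef_fromBlocks_smul_one hG hρ) hκ hq
  have hZ' : Z = Matrix.of fun i => Sum.elim (ltiState A B (u i) (w i) T).ofLp (u i T).ofLp := hZ
  refine ⟨existsUnique_isLeastSquares _ _ _ hZ' hD, fun Ahat Bhat hP => ?_⟩
  have herr := dotProduct_error_of_isLeastSquares hZ' hD (w := fun i => w i T) (A := A) (B := B) hP
  have hquad := fun e => dotProduct_fromBlocks_mulVec (nu := nu) G ρ e
  have hnn : ∀ {k : ℕ} (c : Fin k → ℝ), 0 ≤ c ⬝ᵥ c := fun c => dotProduct_self_star_nonneg c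
  constructor
  · refine norm_le_of_isSphereNet ht ht _ hsA fun a ha b hb => ?_
    have h := herr a.ofLp (Sum.elim b.ofLp 0)
    simp only [Sum.elim_comp_inl, Sum.elim_comp_inr, Matrix.mulVec_zero, add_zero] at h
    rw [h]
    -- For `c = (b, 0)`: `(c ⬝ᵥ e)²` is at most the squared norm of the state part of `e`, hence at
    -- most `1 / lam` times the block quadratic form.
    refine hA a ha b hb (sum_sq_olsWeight_le Z hD _ hκ (by positivity) hq fun e => ?_)
    have h1 : Sum.elim b.ofLp 0 ⬝ᵥ e = b.ofLp ⬝ᵥ (e ∘ Sum.inl) := by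
      simp [dotProduct, Fintype.sum_sum_type]
    have h2 := sq_dotProduct_le b.ofLp (e ∘ Sum.inl)
    rw [dotProduct_self_eq_one_of_norm (ht.1 b hb), one_mul] at h2
    rw [h1, hquad]
    refine h2.trans ?_
    rw [one_div, ← div_eq_inv_mul, le_div_iff₀ hlam]
    have h3 := hlamG (e ∘ Sum.inl)
    have h4 : 0 ≤ ρ * ((e ∘ Sum.inr) ⬝ᵥ (e ∘ Sum.inr)) := mul_nonneg hρ.le (hnn _)
    linarith
  · refine norm_le_of_isSphereNet hr ht _ hsB fun a ha b hb => ?_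
    have h := herr a.ofLp (Sum.elim 0 b.ofLp)
    simp only [Sum.elim_comp_inl, Sum.elim_comp_inr, Matrix.mulVec_zero, zero_add] at h
    rw [h]
    refine hB a ha b hb (sum_sq_olsWeight_le Z hD _ hκ (by positivity) hq fun e => ?_)
    have h1 : Sum.elim 0 b.ofLp ⬝ᵥ e = b.ofLp ⬝ᵥ (e ∘ Sum.inr) := by
      simp [dotProduct, Fintype.sum_sum_type]
    have h2 := sq_dotProduct_le b.ofLp (e ∘ Sum.inr)
    rw [dotProduct_self_eq_one_of_norm (hr.1 b hb), one_mul] at h2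
    rw [h1, hquad]
    refine h2.trans ?_
    rw [one_div, ← div_eq_inv_mul, le_div_iff₀ hρ]
    have h3 := hlamG (e ∘ Sum.inl)
    have h4 : 0 ≤ lam * ((e ∘ Sum.inl) ⬝ᵥ (e ∘ Sum.inl)) := mul_nonneg hlam.le (hnn _)
    linarith

/-- The exponent is `36/16 * m L`, slightly more than the `2 m L` required. The constant 6 becomes
the final 8 after the net factor `4/3`. -/
theorem exp_noise_exponent {σw ρ : ℝ} (hσw : 0 < σw) (hρ : 0 < ρ) {N m L : ℝ} (hN : 0 < N)
    (hm : 0 ≤ m) (hL : 0 ≤ L) :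
    Real.exp (-(6 * σw * (√ρ)⁻¹ * √(m * L / N)) ^ 2 / (2 * (1 / ρ / (N / 8) * σw ^ 2))) ≤
      Real.exp (-(2 * m * L)) := by
  have h : -(6 * σw * (√ρ)⁻¹ * √(m * L / N)) ^ 2 / (2 * (1 / ρ / (N / 8) * σw ^ 2)) =
      -(9 / 4 * (m * L)) := by
    rw [mul_pow, mul_pow, inv_pow, Real.sq_sqrt hρ.le, Real.sq_sqrt (by positivity)]
    field_simp
    ring
  rw [h, Real.exp_le_exp]
  nlinarith [mul_nonneg hm hL]

/-- The failure budget is `2δ/54` for the covariance and `δ/54` for each noise event, in total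
`4δ/54 ≤ δ`. -/
theorem measureReal_not_estimateBounds_le [IsProbabilityMeasure μ] (hT : 1 ≤ T) [NeZero nx]
    (A : Matrix (Fin nx) (Fin nx) ℝ) (B : Matrix (Fin nx) (Fin nu) ℝ)
    {σu σw : ℝ} (hσu : 0 < σu) (hσw : 0 < σw)
    {u : Fin N → ℕ → Ω → EuclideanSpace ℝ (Fin nu)}
    {w : Fin N → ℕ → Ω → EuclideanSpace ℝ (Fin nx)}
    (hu : ∀ i t, Measurable (u i t)) (hw : ∀ i t, Measurable (w i t))
    (hu_law : ∀ i t, HasLaw (u i t) (multivariateGaussian 0 (σu ^ 2 • 1)) μ)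
    (hw_law : ∀ i t, HasLaw (w i t) (multivariateGaussian 0 (σw ^ 2 • 1)) μ)
    (hw_indep : iIndepFun (fun p : Fin N × ℕ => w p.1 p.2) μ)
    (hind : iIndep (noiseSigma u w) μ) {δ : ℝ} (hδ : 0 < δ) (hδ' : δ ≤ 1)
    (hN : 24 * ((nx : ℝ) + nu) * Real.log (54 / δ) ≤ N) :
    μ.real {ω | ¬ EstimateBounds A B T (fun i t => u i t ω) (fun i t => w i t ω)
      (4 / 3 * (6 * σw * (√(minEigenvalue (stateCovSum A B σu σw T)))⁻¹ *
        √((2 * nx + nu) * Real.log (54 / δ) / N)))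
      (4 / 3 * (6 * σw * (√(σu ^ 2))⁻¹ * √((2 * nx + nu) * Real.log (54 / δ) / N)))} ≤ δ := by
  set L := Real.log (54 / δ) with hL
  have hnx : 1 ≤ nx := NeZero.one_le
  have hnx' : (1 : ℝ) ≤ nx := by exact_mod_cast hnx
  have hL0 : 0 < L := Real.log_pos (by rw [lt_div_iff₀ hδ]; linarith)
  have hNpos : (0 : ℝ) < N := lt_of_lt_of_le (by positivity) hN
  set G := stateCovSum A B σu σw T with hGdef
  have hG : G.PosDef := posDef_stateCovSum A B σu hσw hT
  have hlam := minEigenvalue_pos hG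
  have hρ : 0 < σu ^ 2 := by positivity
  obtain ⟨t, ht, ht'⟩ := exists_isSphereNet (EuclideanSpace ℝ (Fin nx))
  obtain ⟨r, hr, hr'⟩ := exists_isSphereNet (EuclideanSpace ℝ (Fin nu))
  rw [finrank_euclideanSpace_fin] at ht' hr'
  let z : Fin N → Ω → Fin nx ⊕ Fin nu → ℝ :=
    fun i ω => regressor A B T (fun t => u i t ω) (fun t => w i t ω)
  have hz : ∀ i, Measurable (z i) := fun i =>
    measurable_regressor A B (fun t _ => hu i t) (fun t _ => hw i t)
  have hwT : iIndepFun (fun i => w i T) μ :=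
    hw_indep.precomp (g := fun i : Fin N => (i, T)) fun i j h => (Prod.mk.inj h).1
  have hzw : IndepFun (fun ω i => z i ω) (fun ω i => w i T ω) μ :=
    indepFun_regressor_noise hind hu hw A B T
  set sA := 6 * σw * (√(minEigenvalue G))⁻¹ * √((2 * nx + nu) * L / N) with hsA
  set sB := 6 * σw * (√(σu ^ 2))⁻¹ * √((2 * nx + nu) * L / N) with hsB
  have hsA0 : 0 ≤ sA := by positivity
  have hsB0 : 0 ≤ sB := by positivity
  have hm : (2 * nx + nu : ℝ) = ((2 * nx + nu : ℕ) : ℝ) := by push_cast; ring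
  have hcov := measureReal_not_quadratic_le z (posDef_fromBlocks_smul_one (nu := nu) hG hρ)
    (fun c => iIndepFun_dotProduct_regressor hind hu hw A B T c)
    (fun c i => hasLaw_dotProduct_regressor hind hu hw hu_law hw_law A B i T c)
  have htailA := measureReal_iUnion_olsWeight_tail hz (fun i => hw i T) hzw hwT
    (fun i => hw_law i T) (fun b : EuclideanSpace ℝ (Fin nx) => (Sum.elim b.ofLp 0 : _ → ℝ))
    ht ht' ht' (1 / minEigenvalue G / (N / 8)) hsA0
  have htailB := measureReal_iUnion_olsWeight_tail hz (fun i => hw i T) hzw hwT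
    (fun i => hw_law i T) (fun b : EuclideanSpace ℝ (Fin nu) => (Sum.elim 0 b.ofLp : _ → ℝ))
    ht ht' hr' (1 / σu ^ 2 / (N / 8)) hsB0
  have hcov' : 2 * 17 ^ Fintype.card (Fin nx ⊕ Fin nu) * Real.exp (-((N : ℝ) / 12)) ≤
      2 * (δ / 54) := by
    rw [Fintype.card_sum, Fintype.card_fin, Fintype.card_fin, mul_assoc]
    refine mul_le_mul_of_nonneg_left ?_ (by norm_num)
    refine le_trans ?_ (seventeen_pow_mul_exp_le (k := nx + nu) (m := nx + nu) le_rfl (by omega)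
      hδ hδ')
    -- The sample-size assumption is exactly `N/12 ≥ 2 (nx + nu) L`.
    gcongr
    push_cast
    linarith
  have htailA' : 17 ^ (nx + nx) * Real.exp (-sA ^ 2 /
      (2 * (1 / minEigenvalue G / (N / 8) * σw ^ 2))) ≤ δ / 54 := by
    -- The dimension `2 nx + nu` dominates both net exponents, `2 nx` for `Â` and `nx + nu` for
    -- `B̂`.
    refine le_trans ?_ (seventeen_pow_mul_exp_le (k := nx + nx) (m := 2 * nx + nu) (by omega)
      (by omega) hδ hδ')
    rw [← hm]
    exact mul_le_mul_of_nonneg_left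
      (exp_noise_exponent (m := 2 * nx + nu) hσw hlam hNpos (by positivity) hL0.le) (by positivity)
  have htailB' : 17 ^ (nx + nu) * Real.exp (-sB ^ 2 /
      (2 * (1 / σu ^ 2 / (N / 8) * σw ^ 2))) ≤ δ / 54 := by
    refine le_trans ?_ (seventeen_pow_mul_exp_le (k := nx + nu) (m := 2 * nx + nu) (by omega)
      (by omega) hδ hδ')
    rw [← hm]
    exact mul_le_mul_of_nonneg_left
      (exp_noise_exponent (m := 2 * nx + nu) hσw hρ hNpos (by positivity) hL0.le) (by positivity)
  refine (measureReal_mono (s₂ := _ ∪ (_ ∪ _)) ?_ (measure_ne_top _ _)).trans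
    ((measureReal_union_le _ _).trans (add_le_add (hcov.trans hcov')
      ((measureReal_union_le _ _).trans (add_le_add (htailA.trans htailA')
        (htailB.trans htailB')))) |>.trans (by linarith))
  intro ω hω
  by_contra hcon
  simp only [Set.mem_union, Set.mem_iUnion, Set.mem_ofPred_eq, not_or, not_exists, not_and,
    not_not, not_lt] at hcon
  exact hω (estimateBounds_of_nets hG hlam (minEigenvalue_mul_le hG.1) hρ
    (by positivity : (0 : ℝ) < N / 8) hsA0 hsB0 ht hr rfl hcon.1 hcon.2.1 hcon.2.2)

end MainTheorem

theorem mainTheorem1 {Ω : Type*} [MeasurableSpace Ω] (μ : Measure Ω) [IsProbabilityMeasure μ]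
    (nx nu N T : ℕ) (hT : 1 ≤ T)
    (A : Matrix (Fin nx) (Fin nx) ℝ) (B : Matrix (Fin nx) (Fin nu) ℝ)
    (σu σw : ℝ) (hσu : 0 < σu) (hσw : 0 < σw)
    (u : Fin N → ℕ → Ω → EuclideanSpace ℝ (Fin nu))
    (w : Fin N → ℕ → Ω → EuclideanSpace ℝ (Fin nx))
    (hu_law : ∀ i t, HasLaw (u i t) (multivariateGaussian 0 (σu ^ 2 • 1)) μ)
    (hw_law : ∀ i t, HasLaw (w i t) (multivariateGaussian 0 (σw ^ 2 • 1)) μ)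
    (hu_indep : iIndepFun (fun p : Fin N × ℕ => u p.1 p.2) μ)
    (hw_indep : iIndepFun (fun p : Fin N × ℕ => w p.1 p.2) μ)
    (huw_indep : IndepFun (fun ω (p : Fin N × ℕ) => u p.1 p.2 ω)
      (fun ω (p : Fin N × ℕ) => w p.1 p.2 ω) μ)
    (δ : ℝ) (hδ : 0 < δ) (hδ' : δ ≤ 1)
    (hN : 24 * ((nx : ℝ) + nu) * Real.log (54 / δ) ≤ N) :
    1 - δ ≤ μ.real {ω |
      (∃! P : Matrix (Fin nx) (Fin nx) ℝ × Matrix (Fin nx) (Fin nu) ℝ,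
        IsLastStepEstimate A B T (fun i t => u i t ω) (fun i t => w i t ω) P) ∧
      ∀ (Ahat : Matrix (Fin nx) (Fin nx) ℝ) (Bhat : Matrix (Fin nx) (Fin nu) ℝ),
        IsLastStepEstimate A B T (fun i t => u i t ω) (fun i t => w i t ω) (Ahat, Bhat) →
        ‖Ahat - A‖ ≤ 8 * σw * minEigenvalue (stateCov A B σu σw T) ^ (-(1 / 2) : ℝ) *
            √((2 * nx + nu) * Real.log (54 / δ) / N) ∧
        ‖Bhat - B‖ ≤ 8 * σw / σu * √((2 * nx + nu) * Real.log (54 / δ) / N)} := by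
  set εA := 8 * σw * minEigenvalue (stateCov A B σu σw T) ^ (-(1 / 2) : ℝ) *
    √((2 * nx + nu) * Real.log (54 / δ) / N) with hεA
  set εB := 8 * σw / σu * √((2 * nx + nu) * Real.log (54 / δ) / N) with hεB
  change 1 - δ ≤ μ.real {ω | EstimateBounds A B T (fun i t => u i t ω) (fun i t => w i t ω) εA εB}
  -- Passing to the complement uses only subadditivity, so measurability of the event is never
  -- needed.
  suffices h : μ.real
      {ω | ¬ EstimateBounds A B T (fun i t => u i t ω) (fun i t => w i t ω) εA εB} ≤ δ by
    have h1 : (1 : ℝ) ≤ μ.real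
        {ω | EstimateBounds A B T (fun i t => u i t ω) (fun i t => w i t ω) εA εB} + μ.real
        {ω | ¬ EstimateBounds A B T (fun i t => u i t ω) (fun i t => w i t ω) εA εB} := by
      refine le_trans ?_ (measureReal_union_le _ _)
      rw [← probReal_univ (μ := μ)]
      exact measureReal_mono (fun ω _ => em _) (measure_ne_top _ _)
    linarith
  -- Without states all matrices involved are trivial, and `minEigenvalue` is zero by convention, so
  -- this case is separate.
  rcases Nat.eq_zero_or_pos nx with rfl | hnx
  · have hall : ∀ ω, EstimateBounds A B T (fun i t => u i t ω) (fun i t => w i t ω) εA εB := by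
      intro ω
      constructor
      · refine existsUnique_of_exists_of_unique ⟨(0, 0), ?_⟩ fun _ _ _ _ => Subsingleton.elim _ _
        unfold IsLastStepEstimate IsLeastSquares
        intro Q
        rw [Subsingleton.elim Q (0, 0)]
      · intro Ahat Bhat _
        rw [Subsingleton.elim (Ahat - A) 0, Subsingleton.elim (Bhat - B) 0, norm_zero, norm_zero]
        have hmin : 0 ≤ minEigenvalue (stateCov A B σu σw T) := by
          simp [minEigenvalue, spectrum.of_subsingleton]
        exact ⟨by positivity, by positivity⟩
    simp only [hall, not_true_eq_false, Set.ofPred_false, measureReal_empty]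
    exact hδ.le
  have : NeZero nx := ⟨hnx.ne'⟩
  -- `HasLaw` provides only a.e. measurability. Measurable versions agree with the originals for all
  -- indices at once almost surely, since there are countably many.
  let u' : Fin N → ℕ → Ω → EuclideanSpace ℝ (Fin nu) :=
    fun i t => (hu_law i t).aemeasurable.mk (u i t)
  let w' : Fin N → ℕ → Ω → EuclideanSpace ℝ (Fin nx) :=
    fun i t => (hw_law i t).aemeasurable.mk (w i t)
  have huu : ∀ i t, u i t =ᵐ[μ] u' i t := fun i t => (hu_law i t).aemeasurable.ae_eq_mk
  have hww : ∀ i t, w i t =ᵐ[μ] w' i t := fun i t => (hw_law i t).aemeasurable.ae_eq_mk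
  have huu' : ∀ᵐ ω ∂μ, ∀ p : Fin N × ℕ, u p.1 p.2 ω = u' p.1 p.2 ω :=
    ae_all_iff.2 fun p => huu p.1 p.2
  have hww' : ∀ᵐ ω ∂μ, ∀ p : Fin N × ℕ, w p.1 p.2 ω = w' p.1 p.2 ω :=
    ae_all_iff.2 fun p => hww p.1 p.2
  have hu_indep' : iIndepFun (fun p : Fin N × ℕ => u' p.1 p.2) μ :=
    (iIndepFun_congr fun p : Fin N × ℕ => huu p.1 p.2).1 hu_indep
  have hw_indep' : iIndepFun (fun p : Fin N × ℕ => w' p.1 p.2) μ :=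
    (iIndepFun_congr fun p : Fin N × ℕ => hww p.1 p.2).1 hw_indep
  have huw_indep' : IndepFun (fun ω (p : Fin N × ℕ) => u' p.1 p.2 ω)
      (fun ω (p : Fin N × ℕ) => w' p.1 p.2 ω) μ :=
    huw_indep.congr (huu'.mono fun ω h => funext h) (hww'.mono fun ω h => funext h)
  have key := measureReal_not_estimateBounds_le hT A B hσu hσw
    (fun i t => (hu_law i t).aemeasurable.measurable_mk)
    (fun i t => (hw_law i t).aemeasurable.measurable_mk)
    (fun i t => (hu_law i t).congr (huu i t).symm) (fun i t => (hw_law i t).congr (hww i t).symm)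
    hw_indep' (iIndep_noiseSigma hu_indep' hw_indep' huw_indep') hδ hδ' hN
  have hpos : 0 < minEigenvalue (stateCovSum A B σu σw T) :=
    minEigenvalue_pos (posDef_stateCovSum A B σu hσw hT)
  have eA : 4 / 3 * (6 * σw * (√(minEigenvalue (stateCovSum A B σu σw T)))⁻¹ *
      √((2 * nx + nu) * Real.log (54 / δ) / N)) = εA := by
    rw [hεA, stateCov_eq_stateCovSum A B σu σw hT, Real.rpow_neg hpos.le, ← Real.sqrt_eq_rpow]
    ring
  have eB : 4 / 3 * (6 * σw * (√(σu ^ 2))⁻¹ * √((2 * nx + nu) * Real.log (54 / δ) / N)) =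
      εB := by
    rw [hεB, Real.sqrt_sq hσu.le]
    ring
  rw [eA, eB] at key
  refine le_trans (le_of_eq (measureReal_congr ?_)) key
  filter_upwards [huu', hww'] with ω h1 h2
  have e1 : (fun i t => u i t ω) = fun i t => u' i t ω := by
    ext1 i; ext1 t; exact h1 (i, t)
  have e2 : (fun i t => w i t ω) = fun i t => w' i t ω := by
    ext1 i; ext1 t; exact h2 (i, t)
  change (¬ EstimateBounds A B T (fun i t => u i t ω) (fun i t => w i t ω) εA εB) =
    ¬ EstimateBounds A B T (fun i t => u' i t ω) (fun i t => w' i t ω) εA εB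
  rw [e1, e2]
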